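/- Let $G=SL(2,\mathbb R)$, $\mathcal G=G\times G$, and let $\mathcal P=P_1(\mathbb R)\times P_1(\mathbb R)$ carry the $SO(2)\times SO(2)$-invariant measure $d\lambda=\frac{dx}{1+x^2}\,\frac{dy}{1+y^2}$ (unique up to a constant factor). For $g=\begin{pmatrix}a&b\\c&d\end{pmatrix}\in G$ put $$xg=\frac{xa+c}{xb+d},\qquad k_g(x)=\Big(\frac{(xb+d)^2+(xa+c)^2}{1+x^2}\Big)^{1/2},\qquad s_g(x)=\frac{xb+d}{|xb+d|}.$$ The ultrahyperbolic BMS group is $\mathcal{HB}=L^2(\mathcal P,\lambda,\mathbb R)\rtimes_T\mathcal G$, where $(T(g,h)\alpha)(x,y)=k_g(x)s_g(x)k_h(y)s_h(y)\,\alpha(xg,yh)$. The group $\mathcal G$ acts on the topological dual $L^{2}(\mathcal P,\lambda,\mathbb R)'$ by $\langle T'(g,h)\phi,\alpha\rangle=\langle\phi,T(g^{-1},h^{-1})\alpha\rangle$, and the little group of $\phi$ is the stabilizer $L_\phi=\{(g,h)\in\mathcal G: T'(g,h)\phi=\phi\}$. The actual little groups of $\mathcal{HB}$ are the subgroups of $\mathcal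 G$ of the form $L_\phi$ with $\phi\neq 0$. Let $R(\theta)=\begin{pmatrix}\cos\theta&\sin\theta\\-\sin\theta&\cos\theta\end{pmatrix}$, so that $SO(2)=\{R(\theta)\}$, and let $C_n\subset SO(2)$ be the cyclic subgroup of order $n$, generated by $R(2\pi/n)$. For integers $N\ge 1$, $p$, $q$ let $$H(N,p,q)=\{(R(\theta),R(\varphi)) : N(p\theta+q\varphi)\in 2\pi\mathbb Z\}.$$ Let $D=\{(I,I),(-I,I),(I,-I),(-I,-I)\}$, and let $E_1$ be the class of all subgroups of the groups $C_n\times C_m$ ($n,m\ge 1$) that have even order and contain $(-I,-I)$ but do not contain $D$. Theorem. (1) Every actual little group $L$ of $\mathcal{HB}$ is either an infinite Lie group of dimension one, in which case it is conjugate in $\mathcal G$ to a group $H(N,p,q)$ with $N,p,q$ odd and $p,q$ relatively prime, or a finite (zero-dimensional) group, in which case it is conjugate in $\mathcal G$ to a group of class $E_1$. (2) The infinite actual little groups contained in $SO(2)\times SO(2)$ are exactly the groups $H(N,p,q)$ with $N,p,q$ odd and $p,q$ relatively prime. (3) The finite actual little groups contained in $SO(2)\times SO(2)$ are exactly the groups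 of class $E_1$. -/

import Mathlib

noncomputable section

open MeasureTheory

namespace HB

/-- `G = SL(2, ℝ)`. -/
abbrev SL2 : Type := Matrix.SpecialLinearGroup (Fin 2) ℝ

/-- `𝒢 = G × G`. -/
abbrev GG : Type := SL2 × SL2

/-! ### The projective line and the right action of `SL(2, ℝ)` on it -/

/-- The real projective line `P₁(ℝ) = ℝ ∪ {∞}`, with inhomogeneous coordinate `x = x₁ / x₂`. -/
abbrev PLine : Type := OnePoint ℝ

/-- The Borel σ-algebra of the projective line. -/
instance instMeasurableSpacePLine : MeasurableSpace PLine := borel PLine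

instance instBorelSpacePLine : BorelSpace PLine := ⟨rfl⟩

/-- A choice of homogeneous coordinates: `(x, 1)` for a finite point `x`, and `(1, 0)` for `∞`. -/
def homog (x : PLine) : Fin 2 → ℝ := OnePoint.rec ![1, 0] (fun t : ℝ => ![t, 1]) x

/-- The point with homogeneous coordinates `(v₀, v₁)`, that is, the ratio `v₀ / v₁`. -/
def ofHomog (v : Fin 2 → ℝ) : PLine := if v 1 = 0 then OnePoint.infty else ((v 0 / v 1 : ℝ) : PLine)

/-- The row vector `(x, 1) g = (x a + c, x b + d)` (and `(1, 0) g = (a, b)` when `x = ∞`). -/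
def row (g : SL2) (x : PLine) : Fin 2 → ℝ := Matrix.vecMul (homog x) (g : Matrix (Fin 2) (Fin 2) ℝ)

/-- The right action `x g = (x a + c) / (x b + d)`. -/
def act (g : SL2) (x : PLine) : PLine := ofHomog (row g x)

/-- The second coordinate of `v`, or the first one if the second one vanishes. -/
def lead (v : Fin 2 → ℝ) : ℝ := if v 1 = 0 then v 0 else v 1

/-- `v₀² + v₁²`. -/
def nsq (v : Fin 2 → ℝ) : ℝ := v 0 ^ 2 + v 1 ^ 2

/-- The factor `k_g(x) = (((x b + d)² + (x a + c)²) / (1 + x²)) ^ (1/2)`. -/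
def kFac (g : SL2) (x : PLine) : ℝ := Real.sqrt (nsq (row g x) / nsq (homog x))

/-- The factor `s_g(x) = (x b + d) / |x b + d|` for finite `x` with `x b + d ≠ 0`; on the
remaining null set of points it is the sign of `lead (row g x)`. -/
def sFac (g : SL2) (x : PLine) : ℝ := lead (row g x) / |lead (row g x)|

theorem homog_coe (t : ℝ) : homog (t : PLine) = ![t, 1] := rfl

theorem homog_infty : homog OnePoint.infty = ![1, 0] := rfl

theorem row_coe (g : SL2) (t : ℝ) :
    row g (t : PLine) = ![t * g.1 0 0 + g.1 1 0, t * g.1 0 1 + g.1 1 1] := by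
  ext i
  fin_cases i <;> simp [row, homog_coe, Matrix.vecMul, dotProduct, Fin.sum_univ_two]

theorem kFac_coe (g : SL2) (x : ℝ) : kFac g (x : PLine) =
    Real.sqrt (((x * g.1 0 1 + g.1 1 1) ^ 2 + (x * g.1 0 0 + g.1 1 0) ^ 2) / (1 + x ^ 2)) := by
  simp only [kFac, row_coe, homog_coe, nsq, Matrix.cons_val_zero, Matrix.cons_val_one, one_pow]
  congr 2 <;> ring

theorem sFac_coe (g : SL2) (x : ℝ) (h : x * g.1 0 1 + g.1 1 1 ≠ 0) : sFac g (x : PLine) =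
    (x * g.1 0 1 + g.1 1 1) / |x * g.1 0 1 + g.1 1 1| := by
  simp [sFac, row_coe, lead, h]

theorem act_coe (g : SL2) (x : ℝ) (h : x * g.1 0 1 + g.1 1 1 ≠ 0) : act g (x : PLine) =
    (((x * g.1 0 0 + g.1 1 0) / (x * g.1 0 1 + g.1 1 1) : ℝ) : PLine) := by
  simp [act, ofHomog, row_coe, h]

theorem homog_ne_zero (x : PLine) : homog x ≠ 0 := by
  induction x using OnePoint.rec with
  | infty => intro h; simpa [homog_infty] using congrFun h 0
  | coe t => intro h; simpa [homog_coe] using congrFun h 1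

theorem nsq_pos {v : Fin 2 → ℝ} (hv : v ≠ 0) : 0 < nsq v := by
  by_contra h
  apply hv
  have h0 : v 0 = 0 := by unfold nsq at h; nlinarith [sq_nonneg (v 0), sq_nonneg (v 1)]
  have h1 : v 1 = 0 := by unfold nsq at h; nlinarith [sq_nonneg (v 0), sq_nonneg (v 1)]
  ext i
  fin_cases i <;> simpa

theorem lead_ne_zero {v : Fin 2 → ℝ} (hv : v ≠ 0) : lead v ≠ 0 := by
  unfold lead
  split_ifs with h
  · intro h0
    apply hv
    ext i
    fin_cases i <;> simpa
  · exact h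

theorem lead_smul (c : ℝ) (hc : c ≠ 0) (v : Fin 2 → ℝ) : lead (c • v) = c * lead v := by
  unfold lead
  by_cases h : v 1 = 0 <;> simp [h, hc]

theorem nsq_smul (c : ℝ) (v : Fin 2 → ℝ) : nsq (c • v) = c ^ 2 * nsq v := by
  simp [nsq]; ring

theorem ofHomog_smul (c : ℝ) (hc : c ≠ 0) (v : Fin 2 → ℝ) : ofHomog (c • v) = ofHomog v := by
  unfold ofHomog
  by_cases h : v 1 = 0
  · simp [h]
  · have : c * v 0 / (c * v 1) = v 0 / v 1 := by field_simp
    simp [h, hc, this]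

theorem vecMul_vecMul_inv (v : Fin 2 → ℝ) (g : SL2) :
    Matrix.vecMul (Matrix.vecMul v g.1) (g⁻¹).1 = v := by
  rw [Matrix.vecMul_vecMul]
  have : g.1 * (g⁻¹).1 = 1 := by
    exact congrArg Subtype.val (mul_inv_cancel g)
  rw [this, Matrix.vecMul_one]

theorem row_ne_zero (g : SL2) (x : PLine) : row g x ≠ 0 := by
  intro h
  apply homog_ne_zero x
  rw [← vecMul_vecMul_inv (homog x) g]
  change Matrix.vecMul (row g x) _ = 0
  rw [h, Matrix.zero_vecMul]

theorem smul_homog_ofHomog {v : Fin 2 → ℝ} (_hv : v ≠ 0) : lead v • homog (ofHomog v) = v := by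
  unfold lead ofHomog
  by_cases h : v 1 = 0
  · ext i
    fin_cases i <;> simp [h, homog_infty]
  · ext i
    fin_cases i <;> simp [h, homog_coe]
    field_simp

theorem ofHomog_homog (x : PLine) : ofHomog (homog x) = x := by
  induction x using OnePoint.rec with
  | infty => simp [homog_infty, ofHomog]
  | coe t => simp [homog_coe, ofHomog]

theorem row_mul (g h : SL2) (x : PLine) :
    row (g * h) x = lead (row g x) • row h (act g x) := by
  unfold row act
  rw [Matrix.SpecialLinearGroup.coe_mul, ← Matrix.vecMul_vecMul, ← Matrix.smul_vecMul]
  congr 1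
  exact (smul_homog_ofHomog (row_ne_zero g x)).symm

theorem row_one (x : PLine) : row 1 x = homog x := by
  simp [row]

theorem act_one (x : PLine) : act 1 x = x := by
  rw [act, row_one, ofHomog_homog]

theorem act_mul (g h : SL2) (x : PLine) : act (g * h) x = act h (act g x) := by
  rw [act, row_mul, ofHomog_smul _ (lead_ne_zero (row_ne_zero g x))]
  rfl

theorem lead_homog (x : PLine) : lead (homog x) = 1 := by
  induction x using OnePoint.rec with
  | infty => simp [homog_infty, lead]
  | coe t => simp [homog_coe, lead]

theorem kFac_one (x : PLine) : kFac 1 x = 1 := by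
  rw [kFac, row_one, div_self (nsq_pos (homog_ne_zero x)).ne', Real.sqrt_one]

theorem sFac_one (x : PLine) : sFac 1 x = 1 := by
  rw [sFac, row_one, lead_homog]; simp

theorem nsq_row (g : SL2) (x : PLine) :
    nsq (row g x) = lead (row g x) ^ 2 * nsq (homog (act g x)) := by
  rw [← nsq_smul, act, smul_homog_ofHomog (row_ne_zero g x)]

theorem kFac_mul (g h : SL2) (x : PLine) : kFac (g * h) x = kFac g x * kFac h (act g x) := by
  have h1 := nsq_pos (homog_ne_zero x)
  have h2 := nsq_pos (homog_ne_zero (act g x))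
  have h3 := nsq_pos (row_ne_zero g x)
  unfold kFac
  rw [← Real.sqrt_mul (div_pos h3 h1).le]
  congr 1
  rw [row_mul, nsq_smul, nsq_row g x]
  field_simp

theorem sFac_mul (g h : SL2) (x : PLine) : sFac (g * h) x = sFac g x * sFac h (act g x) := by
  unfold sFac
  rw [row_mul, lead_smul _ (lead_ne_zero (row_ne_zero g x)), abs_mul, div_mul_div_comm]

/-! ### The rotation-invariant measure -/

/-- The rotation-invariant measure of the projective line (unique up to a constant factor):
`dx / (1 + x²)`, which is half the angular measure `dρ` in the coordinate `x = cot (ρ / 2)`. -/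
def lam1 : Measure PLine :=
  ((volume : Measure ℝ).withDensity (fun x => ENNReal.ofReal (1 / (1 + x ^ 2)))).map
    (fun x : ℝ => (x : PLine))

/-- The torus `𝒫 = P₁(ℝ) × P₁(ℝ)`. -/
abbrev Torus : Type := PLine × PLine

/-- The `SO(2) × SO(2)`-invariant measure `λ` of the torus. -/
def lam : Measure Torus := lam1.prod lam1

theorem measurable_density : Measurable (fun x : ℝ => ENNReal.ofReal (1 / (1 + x ^ 2))) := by
  fun_prop

theorem measurableEmbedding_coe : MeasurableEmbedding (fun x : ℝ => (x : PLine)) :=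
  OnePoint.isOpenEmbedding_coe.measurableEmbedding

instance instSFiniteLam1 : SFinite lam1 := by
  unfold lam1; infer_instance

instance instSFiniteLam : SFinite lam := by
  unfold lam; infer_instance

theorem measurable_of_coe {β : Type*} [MeasurableSpace β] {f : PLine → β}
    (hf : Measurable (fun x : ℝ => f (x : PLine))) : Measurable f := by
  intro s hs
  have h1 : MeasurableSet ((fun x : ℝ => (x : PLine)) '' ((fun x : ℝ => f (x : PLine)) ⁻¹' s)) :=
    measurableEmbedding_coe.measurableSet_image.2 (hf hs)
  have h2 : MeasurableSet ({OnePoint.infty} : Set PLine) := measurableSet_singleton _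
  by_cases hi : f OnePoint.infty ∈ s
  · convert h1.union h2 using 1
    ext x
    induction x using OnePoint.rec with
    | infty => simp [hi]
    | coe t => simp
  · convert h1 using 1
    ext x
    induction x using OnePoint.rec with
    | infty => simp [hi]
    | coe t => simp

theorem measurable_act (g : SL2) : Measurable (act g) := by
  apply measurable_of_coe
  simp only [act, row_coe, ofHomog, Matrix.cons_val_zero, Matrix.cons_val_one]
  refine Measurable.ite ?_ measurable_const ?_
  · exact (measurableSet_singleton (0 : ℝ)).preimage (by fun_prop)
  · exact measurableEmbedding_coe.measurable.comp (by fun_prop)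

theorem measurable_kFac (g : SL2) : Measurable (kFac g) := by
  apply measurable_of_coe
  simp only [kFac_coe]
  fun_prop

theorem measurable_sFac (g : SL2) : Measurable (sFac g) := by
  apply measurable_of_coe
  have h : Measurable (fun x : ℝ => lead (row g (x : PLine))) := by
    simp only [row_coe, lead, Matrix.cons_val_zero, Matrix.cons_val_one]
    refine Measurable.ite ?_ (by fun_prop) (by fun_prop)
    exact (measurableSet_singleton (0 : ℝ)).preimage (by fun_prop)
  exact h.div (continuous_abs.measurable.comp h)

/-- The sum of the squares of the entries of `g`. -/
def frob (g : SL2) : ℝ := g.1 0 0 ^ 2 + g.1 0 1 ^ 2 + g.1 1 0 ^ 2 + g.1 1 1 ^ 2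

theorem frob_nonneg (g : SL2) : 0 ≤ frob g := by unfold frob; positivity

theorem nsq_vecMul_le (v : Fin 2 → ℝ) (g : SL2) :
    nsq (Matrix.vecMul v g.1) ≤ frob g * nsq v := by
  simp only [nsq, frob, Matrix.vecMul, dotProduct, Fin.sum_univ_two]
  nlinarith [sq_nonneg (v 0 * g.1 1 0 - v 1 * g.1 0 0), sq_nonneg (v 0 * g.1 1 1 - v 1 * g.1 0 1)]

theorem kFac_le (g : SL2) (x : PLine) : kFac g x ≤ Real.sqrt (frob g) := by
  unfold kFac
  apply Real.sqrt_le_sqrt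
  rw [div_le_iff₀ (nsq_pos (homog_ne_zero x))]
  exact nsq_vecMul_le _ _

theorem abs_sFac (g : SL2) (x : PLine) : |sFac g x| = 1 := by
  unfold sFac
  rw [abs_div, abs_abs, div_self]
  exact abs_ne_zero.2 (lead_ne_zero (row_ne_zero g x))

/-- The action of `g` distorts the rotation-invariant measure by a bounded factor. -/
theorem map_act_le (g : SL2) : lam1.map (act g) ≤ ENNReal.ofReal (frob g) • lam1 := by
  have hinv : ∀ x, act g⁻¹ (act g x) = x := fun x => by rw [← act_mul, mul_inv_cancel, act_one]
  have hinv' : ∀ x, act g (act g⁻¹ x) = x := fun x => by rw [← act_mul, inv_mul_cancel, act_one]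
  set h : SL2 := g⁻¹ with hh
  set w : ℝ → ENNReal := fun x => ENNReal.ofReal (1 / (1 + x ^ 2)) with hw
  refine Measure.le_iff.2 fun A hA => ?_
  rw [Measure.map_apply (measurable_act g) hA, Measure.smul_apply, smul_eq_mul]
  have hAg := measurable_act g hA
  have hl : ∀ B : Set PLine, MeasurableSet B →
      lam1 B = ∫⁻ x in (fun x : ℝ => (x : PLine)) ⁻¹' B, w x := fun B hB => by
    rw [lam1, Measure.map_apply measurableEmbedding_coe.measurable hB,
      withDensity_apply _ (measurableEmbedding_coe.measurable hB)]
  rw [hl _ hAg, hl _ hA]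
  set m : ℝ → ℝ := fun u => (u * h.1 0 0 + h.1 1 0) / (u * h.1 0 1 + h.1 1 1) with hm
  set V : Set ℝ := (fun x : ℝ => (x : PLine)) ⁻¹' A with hV
  set U : Set ℝ := V ∩ {u : ℝ | u * h.1 0 1 + h.1 1 1 ≠ 0} with hU
  have hVm : MeasurableSet V := measurableEmbedding_coe.measurable hA
  have hUm : MeasurableSet U := by
    refine hVm.inter ?_
    exact ((measurableSet_singleton (0 : ℝ)).compl).preimage (by fun_prop)
  have hdet : ∀ k : SL2, k.1 0 0 * k.1 1 1 - k.1 0 1 * k.1 1 0 = 1 := fun k => by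
    have := k.2
    rwa [Matrix.det_fin_two] at this
  have hsub : (fun x : ℝ => (x : PLine)) ⁻¹' (act g ⁻¹' A) ⊆
      m '' U ∪ {-(g.1 1 1 / g.1 0 1)} := by
    intro x hx
    by_cases h0 : x * g.1 0 1 + g.1 1 1 = 0
    · right
      have hb : g.1 0 1 ≠ 0 := by
        intro hb
        have := hdet g
        rw [hb] at this h0
        simp only [mul_zero, zero_add] at h0
        rw [h0] at this
        simp at this
      simp only [Set.mem_singleton_iff]
      field_simp
      linarith
    · left
      simp only [Set.mem_preimage] at hx
      have hix := hinv (x : PLine)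
      rw [act_coe g x h0] at hx hix
      set u : ℝ := (x * g.1 0 0 + g.1 1 0) / (x * g.1 0 1 + g.1 1 1)
      have hu : u * h.1 0 1 + h.1 1 1 ≠ 0 := by
        intro hu
        simp [act, ofHomog, row_coe, hu] at hix
      refine ⟨u, ⟨hx, hu⟩, ?_⟩
      rw [act_coe h u hu] at hix
      exact OnePoint.coe_injective hix
  have hinj : Set.InjOn m U := by
    intro u hu u' hu' he
    have h1 := hinv' (u : PLine)
    have h2 := hinv' (u' : PLine)
    rw [act_coe h u hu.2] at h1
    rw [act_coe h u' hu'.2] at h2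
    have he' : (u * h.1 0 0 + h.1 1 0) / (u * h.1 0 1 + h.1 1 1) =
      (u' * h.1 0 0 + h.1 1 0) / (u' * h.1 0 1 + h.1 1 1) := he
    rw [he', h2] at h1
    exact (OnePoint.coe_injective h1).symm
  have hder : ∀ u ∈ U, HasDerivWithinAt m (1 / (u * h.1 0 1 + h.1 1 1) ^ 2) U u := by
    intro u hu
    have h1 : HasDerivAt (fun u : ℝ => u * h.1 0 0 + h.1 1 0) (1 * h.1 0 0) u :=
      ((hasDerivAt_id u).mul_const _).add_const _
    have h2 : HasDerivAt (fun u : ℝ => u * h.1 0 1 + h.1 1 1) (1 * h.1 0 1) u :=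
      ((hasDerivAt_id u).mul_const _).add_const _
    have h3 := (h1.div h2 hu.2).hasDerivWithinAt (s := U)
    have e : (1 * h.1 0 0 * (u * h.1 0 1 + h.1 1 1) - (u * h.1 0 0 + h.1 1 0) * (1 * h.1 0 1)) =
        1 := by linear_combination hdet h
    rw [e] at h3
    exact h3
  calc ∫⁻ x in (fun x : ℝ => (x : PLine)) ⁻¹' (act g ⁻¹' A), w x
      ≤ ∫⁻ x in m '' U ∪ {-(g.1 1 1 / g.1 0 1)}, w x := lintegral_mono_set hsub
    _ ≤ (∫⁻ x in m '' U, w x) + ∫⁻ x in {-(g.1 1 1 / g.1 0 1)}, w x :=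
        lintegral_union_le _ _ _
    _ = ∫⁻ x in m '' U, w x := by simp
    _ = ∫⁻ u in U, ENNReal.ofReal |1 / (u * h.1 0 1 + h.1 1 1) ^ 2| * w (m u) :=
        lintegral_image_eq_lintegral_abs_deriv_mul hUm hder hinj _
    _ ≤ ∫⁻ u in U, ENNReal.ofReal (frob g) * w u := by
        refine setLIntegral_mono' hUm fun u hu => ?_
        rw [hw, ← ENNReal.ofReal_mul (abs_nonneg _), ← ENNReal.ofReal_mul (frob_nonneg g)]
        apply ENNReal.ofReal_le_ofReal
        have hne : u * h.1 0 1 + h.1 1 1 ≠ 0 := hu.2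
        have hp : 0 < (u * h.1 0 1 + h.1 1 1) ^ 2 := by positivity
        have hq := nsq_vecMul_le (row h (u : PLine)) g
        have hback : Matrix.vecMul (row h (u : PLine)) g.1 = homog (u : PLine) := by
          have := vecMul_vecMul_inv (homog (u : PLine)) h
          rw [hh, inv_inv] at this
          exact this
        rw [hback, row_coe, homog_coe] at hq
        simp only [nsq, Matrix.cons_val_zero, Matrix.cons_val_one, one_pow] at hq
        rw [abs_of_pos (by positivity), hm]
        simp only
        have e : 1 / (u * h.1 0 1 + h.1 1 1) ^ 2 *
            (1 / (1 + ((u * h.1 0 0 + h.1 1 0) / (u * h.1 0 1 + h.1 1 1)) ^ 2)) =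
            1 / ((u * h.1 0 0 + h.1 1 0) ^ 2 + (u * h.1 0 1 + h.1 1 1) ^ 2) := by
          field_simp
          ring
        rw [e, mul_one_div, div_le_div_iff₀ (by positivity) (by positivity)]
        linarith
    _ ≤ ∫⁻ u in V, ENNReal.ofReal (frob g) * w u := lintegral_mono_set Set.inter_subset_left
    _ = ENNReal.ofReal (frob g) * ∫⁻ u in V, w u :=
        lintegral_const_mul _ measurable_density

/-! ### The representation `T` of `G × G` and its dual -/

/-- The right action of `G × G` on the torus: `(x, y) ↦ (x g, y h)`. -/
def tact (p : GG) (z : Torus) : Torus := (act p.1 z.1, act p.2 z.2)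

/-- The multiplier `k_g(x) s_g(x) k_h(y) s_h(y)`. -/
def mult (p : GG) (z : Torus) : ℝ := kFac p.1 z.1 * sFac p.1 z.1 * kFac p.2 z.2 * sFac p.2 z.2

theorem tact_one (z : Torus) : tact 1 z = z := by simp [tact, act_one]

theorem tact_mul (p q : GG) (z : Torus) : tact (p * q) z = tact q (tact p z) := by
  simp [tact, act_mul]

theorem mult_one (z : Torus) : mult 1 z = 1 := by simp [mult, kFac_one, sFac_one]

theorem mult_mul (p q : GG) (z : Torus) : mult (p * q) z = mult p z * mult q (tact p z) := by
  simp only [mult, tact, Prod.fst_mul, Prod.snd_mul, kFac_mul, sFac_mul]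
  ring

theorem measurable_tact (p : GG) : Measurable (tact p) :=
  ((measurable_act p.1).comp measurable_fst).prodMk ((measurable_act p.2).comp measurable_snd)

theorem measurable_mult (p : GG) : Measurable (mult p) :=
  ((((measurable_kFac p.1).comp measurable_fst).mul
    ((measurable_sFac p.1).comp measurable_fst)).mul
    ((measurable_kFac p.2).comp measurable_snd)).mul ((measurable_sFac p.2).comp measurable_snd)

/-- A bound for the multiplier. -/
def multBound (p : GG) : ℝ := Real.sqrt (frob p.1) * Real.sqrt (frob p.2)

theorem abs_mult_le (p : GG) (z : Torus) : |mult p z| ≤ multBound p := by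
  have h1 : 0 ≤ kFac p.1 z.1 := Real.sqrt_nonneg _
  have h2 : 0 ≤ kFac p.2 z.2 := Real.sqrt_nonneg _
  rw [mult, abs_mul, abs_mul, abs_mul, abs_sFac, abs_sFac, mul_one, mul_one, abs_of_nonneg h1,
    abs_of_nonneg h2, multBound]
  exact mul_le_mul (kFac_le _ _) (kFac_le _ _) h2 (Real.sqrt_nonneg _)

/-- A bound for the distortion of `λ`. -/
def distBound (p : GG) : ENNReal := ENNReal.ofReal (frob p.1) * ENNReal.ofReal (frob p.2)

theorem distBound_ne_top (p : GG) : distBound p ≠ ⊤ :=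
  ENNReal.mul_ne_top ENNReal.ofReal_ne_top ENNReal.ofReal_ne_top

theorem map_tact_le (p : GG) : lam.map (tact p) ≤ distBound p • lam := by
  have h : lam.map (tact p) = (lam1.map (act p.1)).prod (lam1.map (act p.2)) := by
    rw [Measure.map_prod_map _ _ (measurable_act _) (measurable_act _)]
    rfl
  rw [h]
  refine (Measure.prod_mono (map_act_le p.1) (map_act_le p.2)).trans ?_
  rw [Measure.prod_smul_left, Measure.prod_smul_right, smul_smul]
  exact le_rfl

theorem quasiMeasurePreserving_tact (p : GG) : Measure.QuasiMeasurePreserving (tact p) lam lam :=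
  ⟨measurable_tact p, (Measure.absolutelyContinuous_of_le (map_tact_le p)).trans
    Measure.smul_absolutelyContinuous⟩

/-- The real Hilbert space `L²(𝒫, λ, ℝ)`. -/
abbrev L2 : Type := Lp ℝ 2 lam

/-- The operator norm bound for `T(g, h)`. -/
def opBound (p : GG) : ENNReal :=
  ENNReal.ofReal (multBound p) * distBound p ^ (1 / (2 : ENNReal)).toReal

theorem opBound_ne_top (p : GG) : opBound p ≠ ⊤ :=
  ENNReal.mul_ne_top ENNReal.ofReal_ne_top
    (ENNReal.rpow_ne_top_of_nonneg ENNReal.toReal_nonneg (distBound_ne_top p))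

theorem aestronglyMeasurable_T (p : GG) (α : L2) :
    AEStronglyMeasurable (fun z => mult p z * α (tact p z)) lam :=
  (measurable_mult p).aestronglyMeasurable.mul
    ((Lp.aestronglyMeasurable α).comp_quasiMeasurePreserving (quasiMeasurePreserving_tact p))

theorem eLpNorm_T_le (p : GG) (α : L2) :
    eLpNorm (fun z => mult p z * α (tact p z)) 2 lam ≤ opBound p * eLpNorm α 2 lam := by
  have h1 : eLpNorm (fun z => mult p z * α (tact p z)) 2 lam ≤
      ENNReal.ofReal (multBound p) * eLpNorm (α ∘ tact p) 2 lam := by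
    refine eLpNorm_le_mul_eLpNorm_of_ae_le_mul (Filter.Eventually.of_forall fun z => ?_) 2
    rw [norm_mul]
    exact mul_le_mul_of_nonneg_right (abs_mult_le p z) (norm_nonneg _)
  have hm : AEStronglyMeasurable α (lam.map (tact p)) :=
    (Lp.aestronglyMeasurable α).mono_ac (quasiMeasurePreserving_tact p).absolutelyContinuous
  have h2 : eLpNorm (α ∘ tact p) 2 lam ≤
      distBound p ^ (1 / (2 : ENNReal)).toReal * eLpNorm α 2 lam := by
    rw [← eLpNorm_map_measure hm (measurable_tact p).aemeasurable]
    exact (eLpNorm_mono_measure α (map_tact_le p)).trans (eLpNorm_smul_measure_le _ _ _ _)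
  calc _ ≤ _ := h1
    _ ≤ _ := mul_le_mul_right h2 _
    _ = _ := by rw [opBound, mul_assoc]

theorem memLp_T (p : GG) (α : L2) : MemLp (fun z => mult p z * α (tact p z)) 2 lam :=
  ⟨aestronglyMeasurable_T p α, (eLpNorm_T_le p α).trans_lt
    (ENNReal.mul_lt_top (opBound_ne_top p).lt_top (Lp.memLp α).2)⟩

/-- The operator `(T(g, h) α)(x, y) = k_g(x) s_g(x) k_h(y) s_h(y) α(x g, y h)` of
`L²(𝒫, λ, ℝ)`. -/
def opT (p : GG) : L2 →L[ℝ] L2 :=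
  LinearMap.mkContinuous
    { toFun := fun α => (memLp_T p α).toLp _
      map_add' := fun α β => by
        rw [← MemLp.toLp_add]
        apply MemLp.toLp_congr
        filter_upwards [(quasiMeasurePreserving_tact p).ae (Lp.coeFn_add α β)] with z hz
        simp only [Pi.add_apply] at hz ⊢
        rw [hz, mul_add]
      map_smul' := fun c α => by
        rw [RingHom.id_apply, ← MemLp.toLp_const_smul]
        apply MemLp.toLp_congr
        filter_upwards [(quasiMeasurePreserving_tact p).ae (Lp.coeFn_smul c α)] with z hz
        simp only [Pi.smul_apply, smul_eq_mul] at hz ⊢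
        rw [hz]
        ring }
    (opBound p).toReal
    (fun α => by
      simp only [LinearMap.coe_mk, AddHom.coe_mk]
      rw [Lp.norm_toLp, Lp.norm_def, ← ENNReal.toReal_mul]
      exact ENNReal.toReal_mono (ENNReal.mul_ne_top (opBound_ne_top p) (Lp.memLp α).2.ne)
        (eLpNorm_T_le p α))

theorem opT_apply (p : GG) (α : L2) :
    opT p α =ᵐ[lam] fun z => mult p z * α (tact p z) :=
  (memLp_T p α).coeFn_toLp

theorem opT_one : opT 1 = ContinuousLinearMap.id ℝ L2 := by
  ext1 α
  apply Lp.ext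
  filter_upwards [opT_apply 1 α] with z hz
  rw [hz, mult_one, tact_one, one_mul]
  rfl

theorem opT_mul (p q : GG) : opT (p * q) = (opT p).comp (opT q) := by
  ext1 α
  apply Lp.ext
  rw [ContinuousLinearMap.comp_apply]
  filter_upwards [opT_apply (p * q) α, opT_apply p (opT q α),
    (quasiMeasurePreserving_tact p).ae (opT_apply q α)] with z h1 h2 h3
  rw [h1, h2, h3, mult_mul, tact_mul, mul_assoc]

/-- The representation `T` of `G × G` on `L²(𝒫, λ, ℝ)`. -/
def repT : GG →* (L2 →L[ℝ] L2) where
  toFun := opT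
  map_one' := opT_one
  map_mul' := opT_mul

theorem repT_one_apply (α : L2) : repT 1 α = α := by
  change opT 1 α = α
  rw [opT_one, ContinuousLinearMap.id_apply]

theorem repT_mul_apply (p q : GG) (α : L2) : repT (p * q) α = repT p (repT q α) := by
  change opT (p * q) α = opT p (opT q α)
  rw [opT_mul, ContinuousLinearMap.comp_apply]

/-- The action of `G × G` on the additive group `L²(𝒫, λ, ℝ)` through `T`, by automorphisms. -/
def autT : GG →* MulAut (Multiplicative L2) where
  toFun p := AddEquiv.toMultiplicative
    { toFun := fun α => repT p α
      invFun := fun α => repT p⁻¹ α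
      left_inv := fun α => by
        change repT p⁻¹ (repT p α) = α
        rw [← repT_mul_apply, inv_mul_cancel, repT_one_apply]
      right_inv := fun α => by
        change repT p (repT p⁻¹ α) = α
        rw [← repT_mul_apply, mul_inv_cancel, repT_one_apply]
      map_add' := fun α β => map_add _ α β }
  map_one' := by
    refine MulEquiv.ext fun α => ?_
    change Multiplicative.ofAdd (repT 1 (Multiplicative.toAdd α)) = α
    rw [repT_one_apply]; rfl
  map_mul' p q := by
    refine MulEquiv.ext fun α => ?_
    change Multiplicative.ofAdd (repT (p * q) (Multiplicative.toAdd α)) =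
      Multiplicative.ofAdd (repT p (repT q (Multiplicative.toAdd α)))
    rw [repT_mul_apply]

/-- The ultrahyperbolic Bondi-Metzner-Sachs group `L²(𝒫, λ, ℝ) ⋊_T (G × G)`. -/
abbrev UltrahyperbolicBMS : Type := Multiplicative L2 ⋊[autT] GG

/-- The dual action `T'` on the topological dual: `⟨T'(g, h) φ, α⟩ = ⟨φ, T(g⁻¹, h⁻¹) α⟩`. -/
def dualAction (p : GG) (φ : StrongDual ℝ L2) : StrongDual ℝ L2 := φ.comp (repT p⁻¹)

theorem dualAction_one (φ : StrongDual ℝ L2) : dualAction 1 φ = φ := by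
  ext α
  rw [dualAction, inv_one, ContinuousLinearMap.comp_apply, repT_one_apply]

theorem dualAction_mul (p q : GG) (φ : StrongDual ℝ L2) :
    dualAction (p * q) φ = dualAction p (dualAction q φ) := by
  ext α
  rw [dualAction, mul_inv_rev, ContinuousLinearMap.comp_apply, repT_mul_apply]
  rfl

/-- The little group `L_φ`: the stabilizer of `φ` under the dual action. -/
def littleGroup (φ : StrongDual ℝ L2) : Subgroup GG where
  carrier := {p | dualAction p φ = φ}
  one_mem' := dualAction_one φ
  mul_mem' := fun {p q} hp hq => by
    change dualAction (p * q) φ = φ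
    rw [dualAction_mul, show dualAction q φ = φ from hq, show dualAction p φ = φ from hp]
  inv_mem' := fun {p} hp => by
    change dualAction p⁻¹ φ = φ
    conv_lhs => rw [← show dualAction p φ = φ from hp]
    rw [← dualAction_mul, inv_mul_cancel, dualAction_one]

/-- The actual little groups: the little groups of the nonzero functionals. -/
def IsActualLittleGroup (L : Subgroup GG) : Prop :=
  ∃ φ : StrongDual ℝ L2, φ ≠ 0 ∧ littleGroup φ = L

/-! ### Dimension of a closed subgroup of `G × G` -/

/-- The pairs of matrices `(X, Y)` such that `(exp (t X), exp (t Y)) ∈ L` for all real `t`.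
When `L` is closed this is the Lie algebra of `L`. -/
def lieSet (L : Subgroup GG) :
    Set (Matrix (Fin 2) (Fin 2) ℝ × Matrix (Fin 2) (Fin 2) ℝ) :=
  {X | ∀ t : ℝ, ∃ p ∈ L, p.1.1 = NormedSpace.exp (t • X.1) ∧ p.2.1 = NormedSpace.exp (t • X.2)}

/-- The dimension of a closed subgroup `L` as a Lie group. -/
def lieDim (L : Subgroup GG) : ℕ := Module.finrank ℝ (Submodule.span ℝ (lieSet L))

/-! ### Subgroups of `SO(2) × SO(2)` -/

/-- The rotation matrix `R(θ)`. -/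
def rot (θ : ℝ) : SL2 :=
  ⟨!![Real.cos θ, Real.sin θ; -Real.sin θ, Real.cos θ], by
    rw [Matrix.det_fin_two_of]
    linear_combination Real.cos_sq_add_sin_sq θ⟩

theorem rot_zero : rot 0 = 1 := by
  ext i j
  fin_cases i <;> fin_cases j <;> simp [rot]

theorem rot_add (θ φ : ℝ) : rot (θ + φ) = rot θ * rot φ := by
  ext i j
  rw [Matrix.SpecialLinearGroup.coe_mul]
  fin_cases i <;> fin_cases j <;>
    simp [rot, Matrix.mul_apply, Fin.sum_univ_two, Real.cos_add, Real.sin_add] <;> ring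

theorem rot_neg (θ : ℝ) : rot (-θ) = (rot θ)⁻¹ := by
  rw [eq_inv_iff_mul_eq_one, ← rot_add, neg_add_cancel, rot_zero]

/-- `SO(2)` inside `SL(2, ℝ)`. -/
def SO2 : Subgroup SL2 where
  carrier := Set.range rot
  one_mem' := ⟨0, rot_zero⟩
  mul_mem' := by
    rintro _ _ ⟨θ, rfl⟩ ⟨φ, rfl⟩
    exact ⟨θ + φ, rot_add θ φ⟩
  inv_mem' := by
    rintro _ ⟨θ, rfl⟩
    exact ⟨-θ, rot_neg θ⟩

/-- `SO(2) × SO(2)` inside `G × G`. -/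
def torusK : Subgroup GG := SO2.prod SO2

/-- `C_n ⊆ SO(2)`: the cyclic group generated by `R(2π/n)`, of order `n` for `n ≥ 1`. -/
def cyc (n : ℕ) : Subgroup SL2 := Subgroup.zpowers (rot (2 * Real.pi / n))

/-- `H(N, p, q)`: the pairs `(R(θ), R(φ))` with `N (p θ + q φ) ∈ 2πℤ`. -/
def groupH (N : ℕ) (p q : ℤ) : Subgroup GG where
  carrier := {P | ∃ θ φ : ℝ, P = (rot θ, rot φ) ∧
    ∃ k : ℤ, (N : ℝ) * (p * θ + q * φ) = 2 * Real.pi * k}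
  one_mem' := ⟨0, 0, by rw [rot_zero]; rfl, 0, by simp⟩
  mul_mem' := by
    rintro _ _ ⟨θ, φ, rfl, k, hk⟩ ⟨θ', φ', rfl, k', hk'⟩
    refine ⟨θ + θ', φ + φ', by rw [rot_add, rot_add]; rfl, k + k', ?_⟩
    push_cast
    linear_combination hk + hk'
  inv_mem' := by
    rintro _ ⟨θ, φ, rfl, k, hk⟩
    refine ⟨-θ, -φ, by rw [rot_neg, rot_neg]; rfl, -k, ?_⟩
    push_cast
    linear_combination -hk

/-- `D = {(I, I), (-I, I), (I, -I), (-I, -I)}`. -/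
def groupD : Set GG := {(1, 1), (-1, 1), (1, -1), (-1, -1)}

/-- The class `E₁`: the subgroups of some `C_n × C_m` of even order that contain `(-I, -I)` but
do not contain `D`. -/
def IsClassE1 (F : Subgroup GG) : Prop :=
  (∃ n m : ℕ, 0 < n ∧ 0 < m ∧ F ≤ (cyc n).prod (cyc m)) ∧ Even (Nat.card F) ∧
    ((-1, -1) : GG) ∈ F ∧ ¬ groupD ⊆ (F : Set GG)

end HB

end

noncomputable section

open MeasureTheory

namespace HB

/-! Represent `φ` by its density `f` in `L²`. The action of `g` changes the measure by the factor
`k_g ^ (-2)`, so transposing `T` shows that `(g, h)` fixes `φ` iff `f(xg, yh) = s_g(x) s_h(y)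
(k_g(x) k_h(y)) ^ 3 f(x, y)` almost everywhere (`mem_littleGroup_iff`).

Compactness comes from an invariant quadratic form. The function `|f| ^ (2/3)` transforms with the
factor `(k_g k_h) ^ 2`; integrating out `y` cancels the `h` part against the Jacobian and leaves `F`
with `F(xg) = k_g(x) ^ 2 F(x)`. Then `F ^ 2` has factor `k_g ^ 4`, exactly the weight for which `v ↦
∫ (x·v)² / |x|² F(x)² dx` is an invariant form on `ℝ²`. It is finite because `4/3 ≤ 2` and the
measure is finite, and definite because `f ≠ 0`. Hence the first components are simultaneously
conjugate into `SO(2)`, and by symmetry so are the second ones (`exists_conj_le_torusK`).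

Inside `SO(2) × SO(2)` the problem is Fourier analysis. The signs `s_g` are absorbed by characters
`chr m n` with `m`, `n` odd in the half-angle coordinate, and these are complete. So the little
group is the common kernel of the characters `(θ, ψ) ↦ mθ + nψ` over the nonempty odd spectrum of
`f` (`rot_mem_littleGroup_iff`). If the spectrum lies on one line the kernel is some `H(N, p, q)`;
if it contains two independent characters the kernel is finite. Oddness puts `(-I, -I)` in the
kernel and keeps `(-I, I)` out (`classE1_or_groupH`).

Conversely, every group in the list is the common kernel of two odd characters (possibly equal), by
a lattice computation and a parity argument (`exists_odd_characters`). Such a kernel is the exact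
stabilizer of the step function `2 sgn(chr a) + sgn(chr b)`: its absolute value takes only the
values 1 and 3, which forces stabilizing elements to be rotations, and its values record both signs.
-/

theorem det_eq_one (g : SL2) : g.1 0 0 * g.1 1 1 - g.1 0 1 * g.1 1 0 = 1 := by
  have := g.2
  rwa [Matrix.det_fin_two] at this

theorem kFac_pos (g : SL2) (x : PLine) : 0 < kFac g x :=
  Real.sqrt_pos.2 (div_pos (nsq_pos (row_ne_zero g x)) (nsq_pos (homog_ne_zero x)))

theorem kFac_sq (g : SL2) (x : PLine) : kFac g x ^ 2 = nsq (row g x) / nsq (homog x) :=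
  Real.sq_sqrt (div_pos (nsq_pos (row_ne_zero g x)) (nsq_pos (homog_ne_zero x))).le

theorem sFac_sq (g : SL2) (x : PLine) : sFac g x * sFac g x = 1 := by
  rw [← abs_mul_abs_self, abs_sFac, one_mul]

theorem act_inv_act (g : SL2) (x : PLine) : act g⁻¹ (act g x) = x := by
  rw [← act_mul, mul_inv_cancel, act_one]

theorem act_act_inv (g : SL2) (x : PLine) : act g (act g⁻¹ x) = x := by
  rw [← act_mul, inv_mul_cancel, act_one]

theorem tact_inv_tact (p : GG) (z : Torus) : tact p⁻¹ (tact p z) = z := by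
  rw [← tact_mul, mul_inv_cancel, tact_one]

theorem mult_mul_mult_inv (p : GG) (z : Torus) : mult p z * mult p⁻¹ (tact p z) = 1 := by
  rw [← mult_mul, mul_inv_cancel, mult_one]

theorem mult_ne_zero (p : GG) (z : Torus) : mult p z ≠ 0 := by
  intro h0
  have := mult_mul_mult_inv p z
  rw [h0] at this
  simp at this

/-! ### Change of variables for the rotation-invariant measures. -/

theorem lintegral_lam1 {F : PLine → ENNReal} (hF : Measurable F) :
    ∫⁻ x, F x ∂lam1 = ∫⁻ x : ℝ, ENNReal.ofReal (1 / (1 + x ^ 2)) * F (x : PLine) := by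
  rw [lam1, lintegral_map hF measurableEmbedding_coe.measurable]
  exact lintegral_withDensity_eq_lintegral_mul _ measurable_density
    (hF.comp measurableEmbedding_coe.measurable)

instance instIsFiniteMeasureLam1 : IsFiniteMeasure lam1 := by
  refine ⟨?_⟩
  have h := lintegral_lam1 (F := fun _ => 1) measurable_const
  simp only [lintegral_one, mul_one] at h
  rw [h]
  have := integrable_inv_one_add_sq.lintegral_lt_top
  simpa [one_div] using this

instance instIsFiniteMeasureLam : IsFiniteMeasure lam := by
  unfold lam; infer_instance

theorem ae_lam1_iff {P : PLine → Prop} :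
    (∀ᵐ x ∂lam1, P x) ↔ ∀ᵐ x : ℝ, P (x : PLine) := by
  rw [lam1, measurableEmbedding_coe.ae_map_iff, ae_withDensity_iff measurable_density]
  refine ⟨fun h => h.mono fun x hx => hx ?_, fun h => h.mono fun x hx _ => hx⟩
  have : (0 : ℝ) < 1 / (1 + x ^ 2) := by positivity
  simpa using this

theorem ae_denominator_ne_zero (g : SL2) : ∀ᵐ x : ℝ, x * g.1 0 1 + g.1 1 1 ≠ 0 := by
  have hs : {x : ℝ | x * g.1 0 1 + g.1 1 1 = 0}.Subsingleton := by
    intro x hx y hy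
    simp only [Set.mem_ofPred_eq] at hx hy
    have hd := det_eq_one g
    by_contra hne
    have hb : g.1 0 1 = 0 := by
      have : (x - y) * g.1 0 1 = 0 := by linear_combination hx - hy
      exact (mul_eq_zero.1 this).resolve_left (sub_ne_zero.2 hne)
    rw [hb] at hx hd
    simp only [mul_zero, zero_add] at hx
    rw [hx] at hd
    simp at hd
  rw [ae_iff]
  simpa using hs.measure_zero volume

/-- The Jacobian of `act g` with respect to `lam1`. -/
def jac (g : SL2) (x : PLine) : NNReal := Real.toNNReal ((kFac g x ^ 2)⁻¹)

theorem measurable_jac (g : SL2) : Measurable (jac g) :=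
  (((measurable_kFac g).pow_const 2).inv).real_toNNReal

theorem coe_jac (g : SL2) (x : PLine) : (jac g x : ℝ) = (kFac g x ^ 2)⁻¹ :=
  Real.coe_toNNReal _ (by positivity)

/-- The Möbius map has derivative `(xb + d) ^ (-2)`, and combining it with the density `1 / (1 +
x²)` at both ends produces `k_g ^ (-2)`. The pole of the map and the one point missed by its image
are null. -/
theorem lintegral_comp_act (g : SL2) {F : PLine → ENNReal} (hF : Measurable F) :
    ∫⁻ x, jac g x * F (act g x) ∂lam1 = ∫⁻ x, F x ∂lam1 := by
  set w : ℝ → ENNReal := fun x => ENNReal.ofReal (1 / (1 + x ^ 2)) with hw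
  rw [lintegral_lam1 hF, lintegral_lam1 (F := fun x => (jac g x : ENNReal) * F (act g x))
    (((measurable_jac g).coe_nnreal_ennreal).mul (hF.comp (measurable_act g)))]
  set m : ℝ → ℝ := fun u => (u * g.1 0 0 + g.1 1 0) / (u * g.1 0 1 + g.1 1 1) with hm
  set U : Set ℝ := {u : ℝ | u * g.1 0 1 + g.1 1 1 ≠ 0} with hU
  have hUm : MeasurableSet U :=
    ((measurableSet_singleton (0 : ℝ)).compl).preimage (by fun_prop)
  have hact : ∀ u ∈ U, act g (u : PLine) = (m u : PLine) := fun u hu => act_coe g u hu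
  have hinj : Set.InjOn m U := by
    intro u hu u' hu' he
    have h1 := hact u hu
    rw [he, ← hact u' hu'] at h1
    have h2 := congrArg (act g⁻¹) h1
    rw [act_inv_act, act_inv_act] at h2
    exact OnePoint.coe_injective h2
  have hder : ∀ u ∈ U, HasDerivWithinAt m (1 / (u * g.1 0 1 + g.1 1 1) ^ 2) U u := by
    intro u hu
    have h1 : HasDerivAt (fun u : ℝ => u * g.1 0 0 + g.1 1 0) (1 * g.1 0 0) u :=
      ((hasDerivAt_id u).mul_const _).add_const _
    have h2 : HasDerivAt (fun u : ℝ => u * g.1 0 1 + g.1 1 1) (1 * g.1 0 1) u :=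
      ((hasDerivAt_id u).mul_const _).add_const _
    have h3 := (h1.div h2 hu).hasDerivWithinAt (s := U)
    have e : (1 * g.1 0 0 * (u * g.1 0 1 + g.1 1 1) - (u * g.1 0 0 + g.1 1 0) * (1 * g.1 0 1)) =
        1 := by linear_combination det_eq_one g
    rw [e] at h3
    exact h3
  have hUae : ∀ᵐ x : ℝ, x ∈ U := ae_denominator_ne_zero g
  -- A preimage of `x` is computed with `g⁻¹`, so only the pole of `g⁻¹` can be missed.
  have himg : ∀ᵐ x : ℝ, x ∈ m '' U := by
    filter_upwards [ae_denominator_ne_zero g⁻¹] with x hx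
    have h1 := act_act_inv g (x : PLine)
    rw [act_coe g⁻¹ x hx] at h1
    set u : ℝ := (x * g⁻¹.1 0 0 + g⁻¹.1 1 0) / (x * g⁻¹.1 0 1 + g⁻¹.1 1 1)
    have hu : u ∈ U := by
      intro hu
      simp [act, ofHomog, row_coe, hu] at h1
    refine ⟨u, hu, ?_⟩
    rw [hact u hu] at h1
    exact OnePoint.coe_injective h1
  have hr1 : (volume : Measure ℝ).restrict U = volume :=
    Measure.restrict_eq_self_of_ae_mem hUae
  have hr2 : (volume : Measure ℝ).restrict (m '' U) = volume :=
    Measure.restrict_eq_self_of_ae_mem himg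
  have key := lintegral_image_eq_lintegral_abs_deriv_mul hUm hder hinj
    (fun u => w u * F (u : PLine))
  rw [hr2] at key
  rw [key]
  conv_lhs => rw [← hr1]
  refine setLIntegral_congr_fun hUm fun u hu => ?_
  rw [hact u hu, ← mul_assoc, ← mul_assoc]
  congr 1
  have hne : u * g.1 0 1 + g.1 1 1 ≠ 0 := hu
  rw [hw, jac, ← ENNReal.ofReal, ← ENNReal.ofReal_mul (by positivity),
    ← ENNReal.ofReal_mul (by positivity)]
  congr 1
  rw [kFac_sq, row_coe, homog_coe, abs_of_pos (by positivity), hm]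
  simp only [nsq, Matrix.cons_val_zero, Matrix.cons_val_one, one_pow]
  have : 0 < (u * g.1 0 1 + g.1 1 1) ^ 2 := by positivity
  have : 0 < (u * g.1 0 0 + g.1 1 0) ^ 2 + (u * g.1 0 1 + g.1 1 1) ^ 2 := by positivity
  field_simp
  ring

theorem map_act_withDensity (g : SL2) :
    (lam1.withDensity (fun x => (jac g x : ENNReal))).map (act g) = lam1 := by
  refine Measure.ext_of_lintegral _ fun F hF => ?_
  rw [lintegral_map hF (measurable_act g)]
  exact (lintegral_withDensity_eq_lintegral_mul _
    (measurable_jac g).coe_nnreal_ennreal (hF.comp (measurable_act g))).trans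
    (lintegral_comp_act g hF)

/-- The product `k_g(x) k_h(y)`. -/
def kProd (p : GG) (z : Torus) : ℝ := kFac p.1 z.1 * kFac p.2 z.2

theorem kProd_pos (p : GG) (z : Torus) : 0 < kProd p z := mul_pos (kFac_pos _ _) (kFac_pos _ _)

theorem measurable_kProd (p : GG) : Measurable (kProd p) :=
  ((measurable_kFac p.1).comp measurable_fst).mul ((measurable_kFac p.2).comp measurable_snd)

theorem abs_mult (p : GG) (z : Torus) : |mult p z| = kProd p z := by
  rw [mult, abs_mul, abs_mul, abs_mul, abs_sFac, abs_sFac, mul_one, mul_one,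
    abs_of_pos (kFac_pos _ _), abs_of_pos (kFac_pos _ _), kProd]

theorem mult_sq (p : GG) (z : Torus) : mult p z ^ 2 = kProd p z ^ 2 := by
  rw [← sq_abs, abs_mult]

/-- The Jacobian of `tact p` with respect to `lam`. -/
def tjac (p : GG) (z : Torus) : NNReal := jac p.1 z.1 * jac p.2 z.2

theorem measurable_tjac (p : GG) : Measurable (tjac p) :=
  ((measurable_jac p.1).comp measurable_fst).mul ((measurable_jac p.2).comp measurable_snd)

theorem coe_tjac (p : GG) (z : Torus) : (tjac p z : ℝ) = (kProd p z ^ 2)⁻¹ := by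
  rw [tjac, NNReal.coe_mul, coe_jac, coe_jac, kProd, mul_pow, mul_inv]

theorem map_tact_withDensity (p : GG) :
    (lam.withDensity (fun z => (tjac p z : ENNReal))).map (tact p) = lam := by
  have h : lam.withDensity (fun z => (tjac p z : ENNReal)) =
      (lam1.withDensity (fun x => (jac p.1 x : ENNReal))).prod
        (lam1.withDensity (fun x => (jac p.2 x : ENNReal))) := by
    rw [prod_withDensity (measurable_jac _).coe_nnreal_ennreal
      (measurable_jac _).coe_nnreal_ennreal]
    simp only [tjac, ENNReal.coe_mul]
    rfl
  rw [h]
  change Measure.map (Prod.map (act p.1) (act p.2)) _ = _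
  rw [← Measure.map_prod_map _ _ (measurable_act _) (measurable_act _), map_act_withDensity,
    map_act_withDensity, lam]

theorem measurableEmbedding_tact (p : GG) : MeasurableEmbedding (tact p) :=
  MeasurableEquiv.measurableEmbedding
    { toFun := tact p
      invFun := tact p⁻¹
      left_inv := tact_inv_tact p
      right_inv := fun z => by rw [← tact_mul, inv_mul_cancel, tact_one]
      measurable_toFun := measurable_tact p
      measurable_invFun := measurable_tact p⁻¹ }

theorem integral_comp_tact {E : Type*} [NormedAddCommGroup E] [NormedSpace ℝ E] (p : GG)
    (F : Torus → E) :
    ∫ z, (kProd p z ^ 2)⁻¹ • F (tact p z) ∂lam = ∫ z, F z ∂lam := by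
  conv_rhs => rw [← map_tact_withDensity p, (measurableEmbedding_tact p).integral_map,
    integral_withDensity_eq_integral_smul (measurable_tjac p)]
  refine integral_congr_ae (Filter.Eventually.of_forall fun z => ?_)
  simp only
  rw [NNReal.smul_def, coe_tjac]

/-! ### Densities of functionals and the functional equation of a little group. -/

/-- The function representing `φ` in `L²`. -/
def density (φ : StrongDual ℝ L2) : L2 := (InnerProductSpace.toDual ℝ L2).symm φ

theorem apply_eq_integral (φ : StrongDual ℝ L2) (α : L2) :
    φ α = ∫ z, density φ z * α z ∂lam := by
  have h : φ α = inner ℝ (density φ) α := by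
    rw [density, InnerProductSpace.toDual_symm_apply]
  rw [h, L2.inner_def]
  simp [mul_comm]

theorem density_ne_zero {φ : StrongDual ℝ L2} (h : φ ≠ 0) : ¬ (density φ =ᵐ[lam] 0) := by
  intro h0
  apply h
  have : density φ = 0 := by
    apply Lp.ext
    exact h0.trans (Lp.coeFn_zero _ _ _).symm
  simpa [density] using this

/-- The functional with a given density. -/
def ofDensity (f : L2) : StrongDual ℝ L2 := InnerProductSpace.toDual ℝ L2 f

theorem density_ofDensity (f : L2) : density (ofDensity f) = f := by
  simp [density, ofDensity]

/-- The weight equals `mult p` times `(mult ^ 2 * kProd ^ 2)⁻¹ = kProd ^ (-4)`, so `memLp_T` applies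
once this factor is bounded. By the cocycle identity `(kProd p z)⁻¹` is the absolute value of the
multiplier of `p⁻¹` at `tact p z`, which is at most `multBound p⁻¹`. -/
theorem memLp_dual (p : GG) (f : L2) :
    MemLp (fun z => (mult p z * kProd p z ^ 2)⁻¹ * f (tact p z)) 2 lam := by
  have h1 := memLp_T p f
  have h2 : ∀ z, ‖(mult p z ^ 2 * kProd p z ^ 2)⁻¹‖ ≤ multBound p⁻¹ ^ 4 := by
    intro z
    have hk : (kProd p z)⁻¹ ≤ multBound p⁻¹ := by
      have h := abs_mult_le p⁻¹ (tact p z)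
      have h' := congrArg abs (mult_mul_mult_inv p z)
      rw [abs_mul, abs_mult, abs_one] at h'
      rw [← eq_inv_of_mul_eq_one_right h'] 
      exact h
    have hp := kProd_pos p z
    rw [mult_sq, Real.norm_of_nonneg (by positivity)]
    calc (kProd p z ^ 2 * kProd p z ^ 2)⁻¹ = (kProd p z)⁻¹ ^ 4 := by field_simp
      _ ≤ _ := pow_le_pow_left₀ (by positivity) hk 4
  have h3 : AEStronglyMeasurable (fun z => (mult p z ^ 2 * kProd p z ^ 2)⁻¹) lam :=
    ((((measurable_mult p).pow_const 2).mul
      ((measurable_kProd p).pow_const 2)).inv).aestronglyMeasurable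
  have h4 : MemLp (fun z => (mult p z ^ 2 * kProd p z ^ 2)⁻¹ * (mult p z * f (tact p z))) 2 lam :=
    h1.of_le_mul (h3.mul h1.1) (Filter.Eventually.of_forall fun z => by
      rw [norm_mul]
      exact mul_le_mul_of_nonneg_right (h2 z) (norm_nonneg _))
  refine h4.ae_eq (Filter.Eventually.of_forall fun z => ?_)
  have hm := mult_ne_zero p z
  have hp := kProd_pos p z
  simp only
  field_simp

theorem dualAction_apply_eq (p : GG) (φ : StrongDual ℝ L2) (α : L2) :
    dualAction p φ α =
      ∫ z, ((mult p z * kProd p z ^ 2)⁻¹ * density φ (tact p z)) * α z ∂lam := by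
  change φ (opT p⁻¹ α) = _
  rw [apply_eq_integral]
  have h : ∫ z, density φ z * (opT p⁻¹ α) z ∂lam =
      ∫ z, density φ z * (mult p⁻¹ z * α (tact p⁻¹ z)) ∂lam :=
    integral_congr_ae ((opT_apply p⁻¹ α).mono fun z hz => by simp only [hz])
  -- Substituting `tact p z` for the variable moves the group element from `α` to the density, at
  -- the cost of the Jacobian.
  rw [h, ← integral_comp_tact p]
  refine integral_congr_ae (Filter.Eventually.of_forall fun z => ?_)
  simp only [smul_eq_mul]
  rw [tact_inv_tact, eq_inv_of_mul_eq_one_right (mult_mul_mult_inv p z), mul_inv]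
  ring

/-- The factor on the right is `s_g s_h (k_g k_h) ^ 3`: one power of `k` comes from the multiplier
and two from the Jacobian. -/
theorem mem_littleGroup_iff (φ : StrongDual ℝ L2) (p : GG) :
    p ∈ littleGroup φ ↔
      ∀ᵐ z ∂lam, density φ (tact p z) = mult p z * kProd p z ^ 2 * density φ z := by
  have h1 : p ∈ littleGroup φ ↔ (memLp_dual p (density φ)).toLp = density φ := by
    have e : dualAction p φ = ofDensity ((memLp_dual p (density φ)).toLp) := by
      ext α
      rw [dualAction_apply_eq, apply_eq_integral, density_ofDensity]
      refine integral_congr_ae ((memLp_dual p (density φ)).coeFn_toLp.mono fun z hz => ?_)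
      simp only
      rw [hz]
    have e2 : φ = ofDensity (density φ) := by simp [density, ofDensity]
    change dualAction p φ = φ ↔ _
    rw [e]
    exact ⟨fun h => (InnerProductSpace.toDual ℝ L2).injective (h.trans e2),
      fun h => (congrArg ofDensity h).trans e2.symm⟩
  rw [h1, Lp.ext_iff]
  have h2 := (memLp_dual p (density φ)).coeFn_toLp
  constructor
  · intro h
    filter_upwards [h, h2] with z hz hz2
    rw [hz2, inv_mul_eq_iff_eq_mul₀
      (mul_ne_zero (mult_ne_zero p z) (pow_ne_zero 2 (kProd_pos p z).ne'))] at hz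
    exact hz
  · intro h
    filter_upwards [h, h2] with z hz hz2
    rw [hz2, inv_mul_eq_iff_eq_mul₀
      (mul_ne_zero (mult_ne_zero p z) (pow_ne_zero 2 (kProd_pos p z).ne'))]
    exact hz

/-! ### Invariant quadratic forms and conjugation into `SO(2) × SO(2)`. -/

theorem mem_SO2_of_entries {g : SL2} (h0 : g.1 1 1 = g.1 0 0) (h1 : g.1 1 0 = -g.1 0 1) :
    g ∈ SO2 := by
  have hd := det_eq_one g
  rw [h0, h1] at hd
  obtain ⟨w, hw⟩ : ∃ w : ℂ, w = ⟨g.1 0 0, g.1 0 1⟩ := ⟨_, rfl⟩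
  have hn : ‖w‖ = 1 := by
    have : ‖w‖ ^ 2 = 1 := by
      rw [← Complex.normSq_eq_norm_sq, hw, Complex.normSq_mk]; linarith
    nlinarith [norm_nonneg w]
  have hc := Complex.norm_mul_cos_arg w
  have hs := Complex.norm_mul_sin_arg w
  rw [hn, one_mul] at hc hs
  rw [show w.re = g.1 0 0 by rw [hw]] at hc
  rw [show w.im = g.1 0 1 by rw [hw]] at hs
  refine ⟨w.arg, ?_⟩
  ext i j
  fin_cases i <;> fin_cases j <;> simp [rot, hc, hs, h0, h1]

/-- A group preserving a positive definite form `Q` becomes orthogonal after the change of basis by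
a square root of `Q`. Dividing `Q` by the square root of its determinant makes this change of basis
unimodular. -/
theorem exists_conj_mem_SO2 {a b c : ℝ} (ha : 0 < a) (hd : 0 < a * c - b ^ 2) {Γ : Set SL2}
    (hΓ : ∀ g ∈ Γ, ∀ s t : ℝ,
      a * (g.1 0 0 * s + g.1 0 1 * t) ^ 2 +
        2 * b * ((g.1 0 0 * s + g.1 0 1 * t) * (g.1 1 0 * s + g.1 1 1 * t)) +
        c * (g.1 1 0 * s + g.1 1 1 * t) ^ 2 = a * s ^ 2 + 2 * b * (s * t) + c * t ^ 2) :
    ∃ S : SL2, ∀ g ∈ Γ, S * g * S⁻¹ ∈ SO2 := by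
  set δ : ℝ := Real.sqrt (a * c - b ^ 2) with hδ
  have hδp : 0 < δ := Real.sqrt_pos.2 hd
  have hδ2 : δ ^ 2 = a * c - b ^ 2 := Real.sq_sqrt hd.le
  set r : ℝ := Real.sqrt (a / δ) with hr
  have hrp : 0 < r := Real.sqrt_pos.2 (by positivity)
  have hr2 : r ^ 2 = a / δ := Real.sq_sqrt (by positivity)
  -- The Cholesky factor: with `r² = a / δ`, this `S` satisfies `Sᵀ S = Q / δ`.
  refine ⟨⟨!![r, b / (δ * r); 0, 1 / r], by
    rw [Matrix.det_fin_two_of]; field_simp; simp⟩, fun g hg => ?_⟩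
  set S : SL2 := ⟨!![r, b / (δ * r); 0, 1 / r], _⟩ with hS
  have e0 := hΓ g hg 1 0
  have e1 := hΓ g hg 0 1
  have e2 := hΓ g hg 1 1
  have hg1 := det_eq_one g
  have hinv : (S⁻¹).1 = !![1 / r, -(b / (δ * r)); 0, r] := by
    rw [Matrix.SpecialLinearGroup.coe_inv, Matrix.adjugate_fin_two, hS]
    simp
  have hr2' : δ * r ^ 2 = a := by rw [hr2]; field_simp
  have E : (S * g * S⁻¹).1 = S.1 * g.1 * (S⁻¹).1 := by
    simp only [Matrix.SpecialLinearGroup.coe_mul]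
  -- `f1` and `f2` are the top-row entries of `Q g = (gᵀ)⁻¹ Q`, the linear form of the invariance
  -- `gᵀ Q g = Q` for determinant one.
  have f1 : a * (g.1 0 0 - g.1 1 1) + 2 * b * g.1 1 0 = 0 := by
    linear_combination g.1 1 1 * e0 - g.1 1 0 * (e2 - e0 - e1) / 2 -
      (a * g.1 0 0 + b * g.1 1 0) * hg1
  have f2 : a * g.1 0 1 + c * g.1 1 0 = 0 := by
    linear_combination g.1 1 1 * (e2 - e0 - e1) / 2 - g.1 1 0 * e1 -
      (a * g.1 0 1 + b * g.1 1 1) * hg1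
  have hne := hδp.ne'
  have hne' := hrp.ne'
  apply mem_SO2_of_entries
  · rw [E, hinv, hS]
    simp only [Matrix.mul_apply, Fin.sum_univ_two, Matrix.of_apply, Matrix.cons_val_zero,
      Matrix.cons_val_one, Matrix.cons_val', Matrix.cons_val_fin_one]
    field_simp
    linear_combination -f1 + (g.1 1 1 - g.1 0 0) * hr2'
  · rw [E, hinv, hS]
    simp only [Matrix.mul_apply, Fin.sum_univ_two, Matrix.of_apply, Matrix.cons_val_zero,
      Matrix.cons_val_one, Matrix.cons_val', Matrix.cons_val_fin_one]
    field_simp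
    have hr3 : r ^ 2 * δ = a := by rw [mul_comm, hr2']
    have hl : ∀ y : ℝ, y * r ^ 2 * δ = y * a := fun y => by rw [mul_assoc, hr3]
    have hl' : r ^ 2 * g.1 0 1 * δ = a * g.1 0 1 := by rw [← hr3]; ring
    rw [hl, hl', hr3, hδ2]
    linear_combination a * f2 - b * f1

theorem integral_comp_act (g : SL2) (F : PLine → ℝ) :
    ∫ x, (kFac g x ^ 2)⁻¹ * F (act g x) ∂lam1 = ∫ x, F x ∂lam1 := by
  have he : MeasurableEmbedding (act g) := MeasurableEquiv.measurableEmbedding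
    { toFun := act g
      invFun := act g⁻¹
      left_inv := act_inv_act g
      right_inv := act_act_inv g
      measurable_toFun := measurable_act g
      measurable_invFun := measurable_act g⁻¹ }
  conv_rhs => rw [← map_act_withDensity g, he.integral_map,
    integral_withDensity_eq_integral_smul (measurable_jac g)]
  refine integral_congr_ae (Filter.Eventually.of_forall fun x => ?_)
  simp only
  rw [NNReal.smul_def, coe_jac, smul_eq_mul]

theorem measurable_homog (i : Fin 2) : Measurable (fun x : PLine => homog x i) := by
  apply measurable_of_coe
  simp only [homog_coe]
  fin_cases i
  · exact measurable_id
  · exact measurable_const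

theorem abs_homog_mul_le (x : PLine) (i j : Fin 2) :
    |homog x i * homog x j / nsq (homog x)| ≤ 1 := by
  have h := nsq_pos (homog_ne_zero x)
  rw [abs_div, abs_of_pos h, div_le_one h, abs_mul]
  unfold nsq
  have h0 := sq_abs (homog x 0)
  have h1 := sq_abs (homog x 1)
  fin_cases i <;> fin_cases j <;> simp only [Fin.zero_eta, Fin.mk_one] <;>
    nlinarith [sq_nonneg (|homog x 0| - |homog x 1|), sq_nonneg (homog x 0),
      sq_nonneg (homog x 1), abs_nonneg (homog x 0), abs_nonneg (homog x 1)]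

theorem ae_linear_ne_zero {s t : ℝ} (h : s ≠ 0 ∨ t ≠ 0) :
    ∀ᵐ x ∂lam1, homog x 0 * s + homog x 1 * t ≠ 0 := by
  rw [ae_lam1_iff]
  have hs : {x : ℝ | x * s + t = 0}.Subsingleton := by
    intro x hx y hy
    simp only [Set.mem_ofPred_eq] at hx hy
    by_contra hne
    have hb : s = 0 := by
      have : (x - y) * s = 0 := by linear_combination hx - hy
      exact (mul_eq_zero.1 this).resolve_left (sub_ne_zero.2 hne)
    subst hb
    simp at hx h
    exact h hx
  have := hs.measure_zero volume
  rw [ae_iff]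
  simpa [homog_coe] using this

/-- A degree `-4` invariant density on the projective line yields an invariant quadratic form. -/
theorem exists_conj_of_density {G : PLine → ℝ} (hG : Integrable G lam1) (hG0 : ∀ x, 0 ≤ G x)
    (hne : ¬ (G =ᵐ[lam1] 0)) {Γ : Set SL2}
    (hΓ : ∀ g ∈ Γ, ∀ᵐ x ∂lam1, G (act g x) = kFac g x ^ 4 * G x) :
    ∃ S : SL2, ∀ g ∈ Γ, S * g * S⁻¹ ∈ SO2 := by
  set M : Fin 2 → Fin 2 → PLine → ℝ := fun i j x =>
    homog x i * homog x j / nsq (homog x) * G x with hM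
  have hMi : ∀ i j, Integrable (M i j) lam1 := fun i j => by
    refine hG.bdd_mul (c := 1) ?_ (Filter.Eventually.of_forall fun x => abs_homog_mul_le x i j)
    refine Measurable.aestronglyMeasurable ?_
    refine ((measurable_homog i).mul (measurable_homog j)).div ?_
    exact ((measurable_homog 0).pow_const 2).add ((measurable_homog 1).pow_const 2)
  -- `B` averages the squares of linear forms, made homogeneous of degree zero by `nsq`, against the
  -- density `G`.
  set B : ℝ → ℝ → ℝ := fun s t => ∫ x, (homog x 0 * s + homog x 1 * t) ^ 2 / nsq (homog x) * G x
    ∂lam1 with hB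
  have hBe : ∀ s t (x : PLine), (homog x 0 * s + homog x 1 * t) ^ 2 / nsq (homog x) * G x =
      s ^ 2 * M 0 0 x + (2 * (s * t)) * M 0 1 x + t ^ 2 * M 1 1 x := fun s t x => by
    simp only [hM]; ring
  have hBint : ∀ s t, Integrable
      (fun x => (homog x 0 * s + homog x 1 * t) ^ 2 / nsq (homog x) * G x) lam1 := fun s t => by
    simp only [hBe]
    exact (((hMi 0 0).const_mul _).add ((hMi 0 1).const_mul _)).add ((hMi 1 1).const_mul _)
  have hBf : ∀ s t, B s t = (∫ x, M 0 0 x ∂lam1) * s ^ 2 +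
      2 * (∫ x, M 0 1 x ∂lam1) * (s * t) + (∫ x, M 1 1 x ∂lam1) * t ^ 2 := fun s t => by
    simp only [hB, hBe]
    rw [integral_add (f := fun x => s ^ 2 * M 0 0 x + (2 * (s * t)) * M 0 1 x)
      (((hMi 0 0).const_mul _).add ((hMi 0 1).const_mul _))
      ((hMi 1 1).const_mul _), integral_add ((hMi 0 0).const_mul _) ((hMi 0 1).const_mul _),
      integral_const_mul, integral_const_mul, integral_const_mul]
    ring
  have hpos : ∀ s t, (s ≠ 0 ∨ t ≠ 0) → 0 < B s t := fun s t hst => by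
    have h0 : ∀ x, 0 ≤ (homog x 0 * s + homog x 1 * t) ^ 2 / nsq (homog x) * G x := fun x =>
      mul_nonneg (div_nonneg (sq_nonneg _) (nsq_pos (homog_ne_zero x)).le) (hG0 x)
    refine lt_of_le_of_ne (integral_nonneg h0) fun h => hne ?_
    have h1 := (integral_eq_zero_iff_of_nonneg h0 (hBint s t)).1 h.symm
    filter_upwards [h1, ae_linear_ne_zero hst] with x hx hx'
    have := nsq_pos (homog_ne_zero x)
    simpa [hx', this.ne'] using hx
  set a := ∫ x, M 0 0 x ∂lam1
  set b := ∫ x, M 0 1 x ∂lam1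
  set c := ∫ x, M 1 1 x ∂lam1
  have ha : 0 < a := by simpa [hBf] using hpos 1 0 (by simp)
  have hd : 0 < a * c - b ^ 2 := by
    -- The form takes the value `a (ac - b²)` at `(-b, a)`.
    have h := hpos (-b) a (Or.inr ha.ne')
    rw [hBf] at h
    have : 0 < a * (a * c - b ^ 2) := by linarith
    exact (mul_pos_iff_of_pos_left ha).1 this
  refine exists_conj_mem_SO2 ha hd fun g hg s t => ?_
  -- After the substitution `x ↦ xg`, the weight `k ^ 4` of `G` meets the Jacobian `k ^ (-2)`. The
  -- remaining `k ^ 2` is exactly what turns the denominator `nsq (row g x)` back into `nsq (homog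
  -- x)`.
  have key : B (g.1 0 0 * s + g.1 0 1 * t) (g.1 1 0 * s + g.1 1 1 * t) = B s t := by
    simp only [hB]
    rw [← integral_comp_act g
      (fun x => (homog x 0 * s + homog x 1 * t) ^ 2 / nsq (homog x) * G x)]
    refine integral_congr_ae ((hΓ g hg).mono fun x hx => ?_)
    simp only
    have h1 : ∀ i, row g x i = lead (row g x) * homog (act g x) i := fun i => by
      conv_lhs => rw [← smul_homog_ofHomog (row_ne_zero g x)]
      rfl
    have h2 : ∀ i, row g x i = homog x 0 * g.1 0 i + homog x 1 * g.1 1 i := fun i => by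
      simp [row, Matrix.vecMul, dotProduct, Fin.sum_univ_two]
    have h3 : homog x 0 * (g.1 0 0 * s + g.1 0 1 * t) + homog x 1 * (g.1 1 0 * s + g.1 1 1 * t) =
        lead (row g x) * (homog (act g x) 0 * s + homog (act g x) 1 * t) := by
      linear_combination s * (h1 0 - h2 0) + t * (h1 1 - h2 1)
    have h4 := nsq_pos (homog_ne_zero x)
    have h5 := nsq_pos (homog_ne_zero (act g x))
    have h6 := lead_ne_zero (row_ne_zero g x)
    rw [h3, hx, show kFac g x ^ 4 = (kFac g x ^ 2) ^ 2 by ring, kFac_sq, nsq_row]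
    field_simp
  rw [hBf, hBf] at key
  linarith

/-- Integrating out `y` absorbs `k_h ^ 2` into the Jacobian of `h`, so the marginal of `w` scales by
`k_g ^ 2` and its square by `k_g ^ 4`, as `exists_conj_of_density` demands. Square integrability of
`w` makes the squared marginal integrable. -/
theorem exists_conj_fst_of_density {w : Torus → ENNReal} (hw : Measurable w)
    (hfin : ∫⁻ z, w z ^ 2 ∂lam ≠ ⊤) (hne : ¬ (w =ᵐ[lam] 0)) {Γ : Set GG}
    (hΓ : ∀ p ∈ Γ, ∀ᵐ z ∂lam, w (tact p z) = ENNReal.ofReal (kProd p z ^ 2) * w z) :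
    ∃ S : SL2, ∀ p ∈ Γ, S * p.1 * S⁻¹ ∈ SO2 := by
  set F : PLine → ENNReal := fun x => ∫⁻ y, w (x, y) ∂lam1 with hF
  have hFm : Measurable F := hw.lintegral_prod_right'
  have hF2 : ∫⁻ x, F x ^ 2 ∂lam1 ≠ ⊤ := by
    have h1 : ∀ x, F x ^ 2 ≤ lam1 Set.univ * ∫⁻ y, w (x, y) ^ 2 ∂lam1 := fun x => by
      -- Cauchy–Schwarz against the constant function 1, with finite total mass.
      have h := ENNReal.lintegral_mul_le_Lp_mul_Lq lam1 Real.HolderConjugate.two_two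
        (f := fun y => w (x, y)) (g := fun _ => 1)
        (hw.comp measurable_prodMk_left).aemeasurable aemeasurable_const
      simp only [Pi.mul_apply, mul_one, ENNReal.one_rpow, lintegral_one] at h
      calc F x ^ 2 ≤ _ := pow_le_pow_left' h 2
        _ = _ := by
          rw [mul_pow, ← ENNReal.rpow_natCast, ← ENNReal.rpow_natCast, ← ENNReal.rpow_mul,
            ← ENNReal.rpow_mul]
          simp [mul_comm]
    refine ne_top_of_le_ne_top ?_ (lintegral_mono h1)
    rw [lintegral_const_mul _ (hw.pow_const 2).lintegral_prod_right']
    refine ENNReal.mul_ne_top (measure_ne_top _ _) ?_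
    rw [← lintegral_prod _ (hw.pow_const 2).aemeasurable]
    exact hfin
  have hFF : ∀ᵐ x ∂lam1, F x ^ 2 < ⊤ := ae_lt_top (hFm.pow_const 2) hF2
  refine exists_conj_of_density (G := fun x => (F x ^ 2).toReal)
    (Γ := Prod.fst '' Γ) ?_ (fun x => ENNReal.toReal_nonneg) ?_ ?_ |>.imp
    fun S hS p hp => hS p.1 ⟨p, hp, rfl⟩
  · exact integrable_toReal_of_lintegral_ne_top (hFm.pow_const 2).aemeasurable hF2
  · intro h
    apply hne
    have h0 : F =ᵐ[lam1] 0 := by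
      filter_upwards [h, hFF] with x hx hx'
      have := (ENNReal.toReal_eq_zero_iff _).1 hx
      simpa [hx'.ne] using this
    rw [← lintegral_eq_zero_iff hw, lam, lintegral_prod _ hw.aemeasurable]
    exact (lintegral_eq_zero_iff hFm).2 h0
  · rintro _ ⟨p, hp, rfl⟩
    filter_upwards [Measure.ae_ae_of_ae_prod (hΓ p hp)] with x hx
    have h : F (act p.1 x) = ENNReal.ofReal (kFac p.1 x ^ 2) * F x := by
      simp only [hF]
      rw [← lintegral_comp_act p.2 (F := fun y => w (act p.1 x, y))
        (hw.comp measurable_prodMk_left),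
        ← lintegral_const_mul _ (f := fun y => w (x, y)) (hw.comp measurable_prodMk_left)]
      refine lintegral_congr_ae (hx.mono fun y hy => ?_)
      simp only [tact] at hy ⊢
      rw [hy, jac, ← ENNReal.ofReal, ← mul_assoc, ← ENNReal.ofReal_mul (by positivity)]
      congr 2
      have := (kFac_pos p.2 y).ne'
      rw [kProd]
      field_simp
    rw [h, mul_pow, ENNReal.toReal_mul, ← ENNReal.ofReal_pow (by positivity),
      ENNReal.toReal_ofReal (by positivity)]
    ring

/-- Exchanging the two factors of the torus reduces this to the first component. -/
theorem exists_conj_snd_of_density {w : Torus → ENNReal} (hw : Measurable w)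
    (hfin : ∫⁻ z, w z ^ 2 ∂lam ≠ ⊤) (hne : ¬ (w =ᵐ[lam] 0)) {Γ : Set GG}
    (hΓ : ∀ p ∈ Γ, ∀ᵐ z ∂lam, w (tact p z) = ENNReal.ofReal (kProd p z ^ 2) * w z) :
    ∃ S : SL2, ∀ p ∈ Γ, S * p.2 * S⁻¹ ∈ SO2 := by
  have hs : MeasurePreserving (Prod.swap : Torus → Torus) lam lam :=
    ⟨measurable_swap, Measure.prod_swap⟩
  obtain ⟨S, hS⟩ := exists_conj_fst_of_density (w := w ∘ Prod.swap) (hw.comp measurable_swap)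
    (Γ := Prod.swap '' Γ) (by
      have := hs.lintegral_comp (hw.pow_const 2)
      simp only [Function.comp]
      rwa [this]) (fun h => hne (by
      have := hs.quasiMeasurePreserving.ae h
      simp only [Function.comp, Prod.swap_swap] at this
      exact this)) (by
      rintro _ ⟨p, hp, rfl⟩
      filter_upwards [hs.quasiMeasurePreserving.ae (hΓ p hp)] with z hz
      simpa [tact, kProd, mul_comm] using hz)
  exact ⟨S, fun p hp => hS p.swap ⟨p, hp, rfl⟩⟩

/-- The little groups are conjugate to subgroups of `SO(2) × SO(2)`. -/
theorem exists_conj_le_torusK {φ : StrongDual ℝ L2} (hφ : φ ≠ 0) :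
    ∃ S : GG, ∀ p ∈ littleGroup φ, S * p * S⁻¹ ∈ torusK := by
  set f := density φ with hf
  have hfm : Measurable f := (Lp.stronglyMeasurable f).measurable
  -- The exponent `2/3` turns the weight `k ^ 3` of `|f|` into `k ^ 2`, which a Jacobian cancels.
  set w : Torus → ENNReal := fun z => ‖f z‖ₑ ^ (2 / 3 : ℝ) with hw
  have hwm : Measurable w := hfm.enorm.pow_const _
  have hwfin : ∫⁻ z, w z ^ 2 ∂lam ≠ ⊤ := by
    -- `w²` is `|f| ^ (4/3)`, bounded by 1 where `|f| ≤ 1` and by `|f|²` elsewhere.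
    have h1 : ∀ z, w z ^ 2 ≤ 1 + ‖f z‖ₑ ^ 2 := fun z => by
      simp only [hw]
      rw [← ENNReal.rpow_natCast, ← ENNReal.rpow_mul]
      rcases le_total ‖f z‖ₑ 1 with h | h
      · exact (ENNReal.rpow_le_one h (by norm_num)).trans le_self_add
      · refine le_trans ?_ le_add_self
        rw [← ENNReal.rpow_natCast]
        exact ENNReal.rpow_le_rpow_of_exponent_le h (by norm_num)
    refine ne_top_of_le_ne_top ?_ (lintegral_mono h1)
    rw [lintegral_add_left measurable_const, lintegral_one]
    refine ENNReal.add_ne_top.2 ⟨measure_ne_top _ _, ?_⟩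
    have := (Lp.memLp f).2
    rw [eLpNorm_lt_top_iff_lintegral_rpow_enorm_lt_top (by norm_num) (by norm_num)] at this
    simpa using this.ne
  have hwne : ¬ (w =ᵐ[lam] 0) := fun h => density_ne_zero hφ (by
    filter_upwards [h] with z hz
    simpa [hw] using hz)
  have hΓ : ∀ p ∈ (littleGroup φ : Set GG), ∀ᵐ z ∂lam,
      w (tact p z) = ENNReal.ofReal (kProd p z ^ 2) * w z := fun p hp => by
    filter_upwards [(mem_littleGroup_iff φ p).1 hp] with z hz
    simp only [hw, hf]
    rw [hz, enorm_mul, ENNReal.mul_rpow_of_nonneg _ _ (by norm_num)]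
    congr 1
    have hk := kProd_pos p z
    rw [Real.enorm_eq_ofReal_abs, abs_mul, abs_mult, abs_of_pos (by positivity),
      ENNReal.ofReal_rpow_of_pos (by positivity)]
    congr 1
    rw [show kProd p z * kProd p z ^ 2 = kProd p z ^ (3 : ℝ) by norm_cast; ring,
      ← Real.rpow_mul hk.le]
    norm_num
  obtain ⟨S, hS⟩ := exists_conj_fst_of_density hwm hwfin hwne hΓ
  obtain ⟨S', hS'⟩ := exists_conj_snd_of_density hwm hwfin hwne hΓ
  exact ⟨(S, S'), fun p hp => ⟨hS p hp, hS' p hp⟩⟩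

/-! ### The half-angle coordinate and the characters of the torus. -/

/-- The complex number `v₀ + i v₁`. -/
def zeta (v : Fin 2 → ℝ) : ℂ := ⟨v 0, v 1⟩

theorem zeta_smul (c : ℝ) (v : Fin 2 → ℝ) : zeta (c • v) = c * zeta v := by
  apply Complex.ext <;> simp [zeta]

theorem zeta_ne_zero {v : Fin 2 → ℝ} (hv : v ≠ 0) : zeta v ≠ 0 := by
  intro h
  apply hv
  ext i
  fin_cases i
  · exact congrArg Complex.re h
  · exact congrArg Complex.im h

theorem zeta_row_rot (θ : ℝ) (x : PLine) :
    zeta (row (rot θ) x) = zeta (homog x) * Complex.exp (θ * Complex.I) := by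
  apply Complex.ext <;>
    simp [zeta, row, rot, Matrix.vecMul, dotProduct, Fin.sum_univ_two,
      Complex.exp_ofReal_mul_I_re, Complex.exp_ofReal_mul_I_im]
  ring

theorem zeta_homog_coe (t : ℝ) : zeta (homog (t : PLine)) = t + Complex.I := by
  apply Complex.ext <;> simp [zeta, homog_coe]

theorem zeta_homog_infty : zeta (homog OnePoint.infty) = 1 := by
  apply Complex.ext <;> simp [zeta, homog_infty]

theorem nsq_eq_normSq (v : Fin 2 → ℝ) : nsq v = Complex.normSq (zeta v) := by
  simp [nsq, zeta, Complex.normSq_mk]; ring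

theorem kFac_rot (θ : ℝ) (x : PLine) : kFac (rot θ) x = 1 := by
  rw [kFac, nsq_eq_normSq, nsq_eq_normSq, zeta_row_rot, Complex.normSq_mul,
    Complex.normSq_eq_norm_sq (Complex.exp _), Complex.norm_exp_ofReal_mul_I, one_pow, mul_one,
    div_self, Real.sqrt_one]
  rw [← nsq_eq_normSq]
  exact (nsq_pos (homog_ne_zero x)).ne'

/-- The unit complex number in the direction of the homogeneous coordinates of a point. -/
def uni (x : PLine) : ℂ := zeta (homog x) / ‖zeta (homog x)‖

theorem norm_uni (x : PLine) : ‖uni x‖ = 1 := by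
  have := norm_ne_zero_iff.2 (zeta_ne_zero (homog_ne_zero x))
  rw [uni, norm_div, Complex.norm_real, norm_norm, div_self this]

theorem uni_ne_zero (x : PLine) : uni x ≠ 0 := by
  rw [← norm_ne_zero_iff, norm_uni]; exact one_ne_zero

/-- A rotation multiplies the homogeneous vector by `exp(iθ)`. Returning to the chosen
representative of the line may cost a sign, and that sign is `s_g`. -/
theorem uni_act_rot (θ : ℝ) (x : PLine) :
    uni (act (rot θ) x) = sFac (rot θ) x * (uni x * Complex.exp (θ * Complex.I)) := by
  have h1 := zeta_row_rot θ x
  have h2 : zeta (row (rot θ) x) =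
      lead (row (rot θ) x) * zeta (homog (act (rot θ) x)) := by
    rw [← zeta_smul, act, smul_homog_ofHomog (row_ne_zero _ x)]
  have hl := lead_ne_zero (row_ne_zero (rot θ) x)
  rw [h1] at h2
  set l := lead (row (rot θ) x)
  have h3 := congrArg norm h2
  rw [norm_mul, Complex.norm_exp_ofReal_mul_I, mul_one, norm_mul, Complex.norm_real,
    Real.norm_eq_abs] at h3
  have hn := norm_ne_zero_iff.2 (zeta_ne_zero (homog_ne_zero (act (rot θ) x)))
  have hlc : (l : ℂ) ≠ 0 := Complex.ofReal_ne_zero.2 hl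
  have hla : ((|l| : ℝ) : ℂ) ≠ 0 := Complex.ofReal_ne_zero.2 (abs_ne_zero.2 hl)
  have hnc : ((‖zeta (homog (act (rot θ) x))‖ : ℝ) : ℂ) ≠ 0 := Complex.ofReal_ne_zero.2 hn
  have hs : (sFac (rot θ) x : ℂ) = l / (|l| : ℝ) := by rw [sFac]; push_cast; rfl
  have hll : ((|l| : ℝ) : ℂ) * (|l| : ℝ) = l * l := by
    rw [← Complex.ofReal_mul, abs_mul_abs_self, Complex.ofReal_mul]
  rw [uni, uni, hs, div_mul_eq_mul_div (zeta (homog x)), h2, h3, Complex.ofReal_mul]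
  field_simp
  linear_combination zeta (homog (act (rot θ) x)) * hll

theorem measurable_zeta_homog : Measurable (fun x : PLine => zeta (homog x)) := by
  apply measurable_of_coe
  simp only [zeta_homog_coe]
  fun_prop

theorem measurable_uni : Measurable uni :=
  measurable_zeta_homog.div (Complex.measurable_ofReal.comp measurable_zeta_homog.norm)

theorem coe_sub_I_ne_zero (t : ℝ) : (t - Complex.I : ℂ) ≠ 0 := by
  intro h; simpa using congrArg Complex.im h

/-- The square of `uni`, that is, the Cayley transform `(x + i) / (x - i)`. -/
theorem uni_sq_coe (t : ℝ) : uni (t : PLine) ^ 2 = (t + Complex.I) / (t - Complex.I) := by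
  have h1 : ((‖(t + Complex.I : ℂ)‖ : ℝ) : ℂ) ^ 2 = (t + Complex.I) * (t - Complex.I) := by
    rw [← Complex.ofReal_pow, ← Complex.normSq_eq_norm_sq, ← Complex.mul_conj]
    simp [sub_eq_add_neg]
  have hp : (t + Complex.I : ℂ) ≠ 0 := by
    rw [← zeta_homog_coe]; exact zeta_ne_zero (homog_ne_zero _)
  have hm := coe_sub_I_ne_zero t
  rw [uni, zeta_homog_coe, div_pow, h1]
  field_simp

theorem uni_infty : uni OnePoint.infty = 1 := by
  simp [uni, zeta_homog_infty]

/-- `uni` itself changes sign across infinity; its square does not, since the Cayley transform `1 +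
2i / (t - i)` tends to 1 in both directions. -/
theorem continuous_uni_sq : Continuous (fun x => uni x ^ 2) := by
  rw [OnePoint.continuous_iff]
  simp only [uni_sq_coe, uni_infty, one_pow]
  constructor
  · have h1 : ∀ t : ℝ, (t + Complex.I : ℂ) / (t - Complex.I) =
        1 + 2 * Complex.I * (t - Complex.I)⁻¹ := fun t => by
      have := coe_sub_I_ne_zero t
      field_simp
      ring
    simp only [h1]
    have h2 : Filter.Tendsto (fun t : ℝ => (t - Complex.I : ℂ)) (Filter.coclosedCompact ℝ)
        (Filter.cocompact ℂ) := by
      rw [Filter.coclosedCompact_eq_cocompact]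
      have := (Complex.isometry_ofReal.isClosedEmbedding.tendsto_cocompact)
      exact (Homeomorph.subRight Complex.I).isClosedEmbedding.tendsto_cocompact.comp this
    have h3 : Filter.Tendsto (fun t : ℝ => (t - Complex.I : ℂ)⁻¹) (Filter.coclosedCompact ℝ)
        (nhds 0) := by
      rw [← Metric.cobounded_eq_cocompact] at h2
      exact Filter.tendsto_inv₀_cobounded.comp h2
    simpa using (h3.const_mul (2 * Complex.I)).const_add 1
  · exact Continuous.div (by fun_prop) (by fun_prop) coe_sub_I_ne_zero

theorem uni_sq_injective : Function.Injective (fun x => uni x ^ 2) := by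
  have h1 : ∀ t : ℝ, uni (t : PLine) ^ 2 ≠ 1 := fun t h => by
    rw [uni_sq_coe, div_eq_one_iff_eq (coe_sub_I_ne_zero t)] at h
    have := congrArg Complex.im h
    norm_num at this
  intro x y h
  simp only at h
  induction x using OnePoint.rec with
  | infty =>
    induction y using OnePoint.rec with
    | infty => rfl
    | coe t => rw [uni_infty, one_pow] at h; exact absurd h.symm (h1 t)
  | coe s =>
    induction y using OnePoint.rec with
    | infty => rw [uni_infty, one_pow] at h; exact absurd h (h1 s)
    | coe t =>
      rw [uni_sq_coe, uni_sq_coe, div_eq_div_iff (coe_sub_I_ne_zero s) (coe_sub_I_ne_zero t)] at h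
      have := congrArg Complex.im h
      simp at this
      rw [show s = t by linarith]

/-- Second countability identifies the Borel σ-algebra of the torus with the product σ-algebra on
which `lam` lives. -/
instance instSecondCountablePLine : SecondCountableTopology PLine :=
  (onePointEquivSphereOfFinrankEq (ι := Fin 2) (V := ℝ) (by simp)).isInducing.secondCountableTopology

/-- The characters of the torus. -/
def chr (m n : ℤ) (z : Torus) : ℂ := uni z.1 ^ m * uni z.2 ^ n

theorem chr_ne_zero (m n : ℤ) (z : Torus) : chr m n z ≠ 0 :=
  mul_ne_zero (zpow_ne_zero _ (uni_ne_zero _)) (zpow_ne_zero _ (uni_ne_zero _))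

theorem norm_chr (m n : ℤ) (z : Torus) : ‖chr m n z‖ = 1 := by
  simp [chr, norm_uni]

theorem measurable_zpow_complex (n : ℤ) : Measurable (fun z : ℂ => z ^ n) := by
  cases n with
  | ofNat n =>
    simp only [Int.ofNat_eq_natCast, zpow_natCast]
    fun_prop
  | negSucc n =>
    simp only [zpow_negSucc]
    fun_prop

theorem measurable_chr (m n : ℤ) : Measurable (chr m n) :=
  ((measurable_zpow_complex m).comp (measurable_uni.comp measurable_fst)).mul
    ((measurable_zpow_complex n).comp (measurable_uni.comp measurable_snd))

theorem chr_mul (m n m' n' : ℤ) (z : Torus) :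
    chr m n z * chr m' n' z = chr (m + m') (n + n') z := by
  rw [chr, chr, chr, zpow_add₀ (uni_ne_zero _), zpow_add₀ (uni_ne_zero _)]
  ring

/-- The squares of `uni` in the two variables are continuous and separate points. By
Stone–Weierstrass the even characters therefore span a dense subspace of the continuous functions,
and these are dense in `L²`. -/
-- In the proof, `H` is the conjugate of `h`, so pairing with `H` integrates against `h` itself.
theorem ae_eq_zero_of_forall_even {h : Torus → ℂ} (hh : MemLp h 2 lam)
    (h0 : ∀ k l : ℤ, ∫ z, chr (2 * k) (2 * l) z * h z ∂lam = 0) : h =ᵐ[lam] 0 := by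
  set H : Lp ℂ 2 lam := (hh.star).toLp with hH
  set Φ : C(Torus, ℂ) →L[ℂ] ℂ :=
    (innerSL ℂ H).comp (ContinuousMap.toLp 2 lam ℂ : C(Torus, ℂ) →L[ℂ] Lp ℂ 2 lam) with hΦ
  have hΦa : ∀ g : C(Torus, ℂ), Φ g = ∫ z, g z * h z ∂lam := fun g => by
    change inner ℂ H (ContinuousMap.toLp 2 lam ℂ g) = _
    rw [L2.inner_def]
    refine integral_congr_ae ?_
    filter_upwards [hh.star.coeFn_toLp, ContinuousMap.coeFn_toLp (p := 2) (𝕜 := ℂ) lam g]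
      with z h1 h2
    rw [hH, h1, h2]
    simp
  set E1 : C(Torus, ℂ) := ⟨fun z => uni z.1 ^ 2, continuous_uni_sq.comp continuous_fst⟩ with hE1
  set E2 : C(Torus, ℂ) := ⟨fun z => uni z.2 ^ 2, continuous_uni_sq.comp continuous_snd⟩ with hE2
  set A : StarSubalgebra ℂ C(Torus, ℂ) := StarAlgebra.adjoin ℂ {E1, E2} with hA
  have hsep : A.SeparatesPoints := by
    intro z z' hz
    by_cases h1 : z.1 = z'.1
    · have h2 : z.2 ≠ z'.2 := fun h2 => hz (Prod.ext h1 h2)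
      exact ⟨E2, ⟨E2, StarAlgebra.subset_adjoin ℂ _ (by simp), rfl⟩,
        fun h => h2 (uni_sq_injective h)⟩
    · exact ⟨E1, ⟨E1, StarAlgebra.subset_adjoin ℂ _ (by simp), rfl⟩,
        fun h => h1 (uni_sq_injective h)⟩
  have hconj : ∀ x, star (uni x ^ 2) = uni x ^ (-2 : ℤ) := fun x => by
    rw [zpow_neg]
    refine eq_inv_of_mul_eq_one_left ?_
    have h1 : star (uni x) * uni x = 1 := by
      rw [Complex.star_def, mul_comm, Complex.mul_conj, Complex.normSq_eq_norm_sq, norm_uni]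
      simp
    calc star (uni x ^ 2) * uni x ^ (2 : ℤ) = (star (uni x) * uni x) ^ 2 := by
          rw [star_pow, mul_pow]; norm_cast
      _ = 1 := by rw [h1, one_pow]
  have hcl : ∀ g ∈ Submonoid.closure ({E1, E2} ∪ star {E1, E2} : Set C(Torus, ℂ)),
      ∃ k l : ℤ, ∀ z, g z = chr (2 * k) (2 * l) z := by
    intro g hg
    induction hg using Submonoid.closure_induction with
    | mem g hg =>
      simp only [Set.mem_union, Set.mem_insert_iff, Set.mem_singleton_iff, Set.mem_star] at hg
      rcases hg with (rfl | rfl) | (h | h)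
      · exact ⟨1, 0, fun z => by simp [chr, hE1]⟩
      · exact ⟨0, 1, fun z => by simp [chr, hE2]⟩
      · refine ⟨-1, 0, fun z => ?_⟩
        rw [← star_star g, h]
        simpa [chr, hE1] using hconj z.1
      · refine ⟨0, -1, fun z => ?_⟩
        rw [← star_star g, h]
        simpa [chr, hE2] using hconj z.2
    | one => exact ⟨0, 0, fun z => by simp [chr]⟩
    | mul g g' _ _ hg hg' =>
      obtain ⟨k, l, h1⟩ := hg
      obtain ⟨k', l', h2⟩ := hg'
      refine ⟨k + k', l + l', fun z => ?_⟩
      rw [ContinuousMap.mul_apply, h1, h2, chr_mul, mul_add, mul_add]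
  have hAker : ∀ g ∈ A, Φ g = 0 := by
    intro g hg
    have hg' : g ∈ Subalgebra.toSubmodule A.toSubalgebra := hg
    rw [hA, StarAlgebra.adjoin_eq_span] at hg'
    clear hg
    induction hg' using Submodule.span_induction with
    | mem g hg =>
      obtain ⟨k, l, h1⟩ := hcl g hg
      rw [hΦa]
      simp only [h1]
      exact h0 k l
    | zero => exact map_zero _
    | add g g' _ _ h1 h2 => rw [map_add, h1, h2, add_zero]
    | smul c g _ h1 => rw [map_smul, h1, smul_zero]
  have hall : ∀ g, Φ g = 0 := by
    intro g
    have h1 : g ∈ A.topologicalClosure := by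
      rw [ContinuousMap.starSubalgebra_topologicalClosure_eq_top_of_separatesPoints A hsep]
      trivial
    have h2 : closure (A : Set C(Torus, ℂ)) ⊆ {g | Φ g = 0} :=
      closure_minimal hAker (isClosed_eq Φ.continuous continuous_const)
    exact h2 h1
  have hH0 : H = 0 := DenseRange.eq_zero_of_inner_left ℂ
    (ContinuousMap.toLp_denseRange ℂ lam ℂ (p := 2) (by norm_num)) hall
  have h3 : star h =ᵐ[lam] 0 := by
    refine (hh.star.coeFn_toLp).symm.trans ?_
    rw [← hH, hH0]
    exact Lp.coeFn_zero _ _ _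
  filter_upwards [h3] with z hz
  simpa using hz

/-- The Fourier coefficients of a function on the torus. -/
def fc (f : Torus → ℝ) (m n : ℤ) : ℂ := ∫ z, (f z : ℂ) * chr m n z ∂lam

/-- Multiplication by the unimodular `chr 1 1` exchanges odd and even characters, so completeness of
the even ones passes to the odd ones. -/
theorem ae_eq_zero_of_fc {f : Torus → ℝ} (hf : MemLp f 2 lam)
    (h : ∀ m n : ℤ, Odd m → Odd n → fc f m n = 0) : f =ᵐ[lam] 0 := by
  have h1 : MemLp (fun z => (f z : ℂ) * chr 1 1 z) 2 lam := by
    refine hf.of_le ?_ (Filter.Eventually.of_forall fun z => ?_)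
    · exact (Complex.measurable_ofReal.comp_aemeasurable
        hf.1.aemeasurable).aestronglyMeasurable.mul (measurable_chr 1 1).aestronglyMeasurable
    · rw [norm_mul, norm_chr, mul_one, Complex.norm_real]
  have h2 := ae_eq_zero_of_forall_even h1 fun k l => by
    have := h (2 * k + 1) (2 * l + 1) ⟨k, rfl⟩ ⟨l, rfl⟩
    rw [← this, fc]
    refine integral_congr_ae (Filter.Eventually.of_forall fun z => ?_)
    simp only
    rw [← chr_mul]
    ring
  filter_upwards [h2] with z hz
  have := (mul_eq_zero.1 hz).resolve_right (chr_ne_zero 1 1 z)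
  exact_mod_cast this

/-! ### Rotations acting on Fourier coefficients. -/

theorem rot_zpow (θ : ℝ) (k : ℤ) : rot (k * θ) = rot θ ^ k := by
  let f : Multiplicative ℝ →* SL2 :=
    { toFun := fun t => rot (Multiplicative.toAdd t)
      map_one' := rot_zero
      map_mul' := fun a b => rot_add _ _ }
  have h := map_zpow f (Multiplicative.ofAdd θ) k
  rw [← ofAdd_zsmul, zsmul_eq_mul] at h
  exact h

theorem rot_eq_one_iff {θ : ℝ} : rot θ = 1 ↔ ∃ k : ℤ, θ = 2 * Real.pi * k := by
  constructor
  · intro h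
    have h1 : Real.cos θ = 1 := congrFun (congrFun (congrArg Subtype.val h) 0) 0
    obtain ⟨k, hk⟩ := (Real.cos_eq_one_iff θ).1 h1
    exact ⟨k, by rw [← hk]; ring⟩
  · rintro ⟨k, rfl⟩
    rw [mul_comm, rot_zpow]
    have : rot (2 * Real.pi) = 1 := by
      ext i j
      fin_cases i <;> fin_cases j <;> simp [rot]
    rw [this, one_zpow]

theorem rot_eq_rot_iff {θ ψ : ℝ} : rot θ = rot ψ ↔ ∃ k : ℤ, θ = ψ + 2 * Real.pi * k := by
  rw [← mul_inv_eq_one, ← rot_neg, ← rot_add, rot_eq_one_iff]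
  exact exists_congr fun k => by constructor <;> intro h <;> linarith

theorem rot_pi : rot Real.pi = -1 := by
  ext i j
  fin_cases i <;> fin_cases j <;> simp [rot]

theorem mult_rot (θ ψ : ℝ) (z : Torus) :
    mult (rot θ, rot ψ) z = sFac (rot θ) z.1 * sFac (rot ψ) z.2 := by
  simp [mult, kFac_rot]

theorem kProd_rot (θ ψ : ℝ) (z : Torus) : kProd (rot θ, rot ψ) z = 1 := by
  simp [kProd, kFac_rot]

theorem zpow_odd_of_sq_eq_one {s : ℂ} (hs : s * s = 1) {m : ℤ} (hm : Odd m) : s ^ m = s := by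
  obtain ⟨k, rfl⟩ := hm
  have h0 : s ≠ 0 := fun h => by simp [h] at hs
  rw [zpow_add₀ h0, zpow_mul, zpow_one, show s ^ (2 : ℤ) = 1 by rw [zpow_two, hs], one_zpow,
    one_mul]

/-- Odd powers preserve the signs `s_g`, so an odd character is an eigenfunction of the rotations up
to exactly the multiplier of `T`. This is why only odd exponents enter the classification. -/
theorem chr_tact_rot {m n : ℤ} (hm : Odd m) (hn : Odd n) (θ ψ : ℝ) (z : Torus) :
    chr m n (tact (rot θ, rot ψ) z) = mult (rot θ, rot ψ) z *
      (Complex.exp ((m * θ + n * ψ : ℝ) * Complex.I) * chr m n z) := by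
  have hs : ∀ (g : SL2) (x : PLine), (sFac g x : ℂ) * sFac g x = 1 := fun g x => by
    rw [← Complex.ofReal_mul, sFac_sq, Complex.ofReal_one]
  simp only [chr, tact, mult_rot]
  rw [uni_act_rot, uni_act_rot, mul_zpow, mul_zpow, mul_zpow, mul_zpow,
    zpow_odd_of_sq_eq_one (hs _ _) hm, zpow_odd_of_sq_eq_one (hs _ _) hn, ← Complex.exp_int_mul,
    ← Complex.exp_int_mul]
  have : Complex.exp ((m * θ + n * ψ : ℝ) * Complex.I) =
      Complex.exp (m * (θ * Complex.I)) * Complex.exp (n * (ψ * Complex.I)) := by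
    rw [← Complex.exp_add]; push_cast; congr 1; ring
  rw [this]
  push_cast
  ring

theorem mult_rot_sq (θ ψ : ℝ) (z : Torus) :
    (mult (rot θ, rot ψ) z : ℂ) * mult (rot θ, rot ψ) z = 1 := by
  rw [← Complex.ofReal_mul, ← sq, mult_sq, kProd_rot]; simp

theorem fc_rot {f : Torus → ℝ} {m n : ℤ} (hm : Odd m) (hn : Odd n) (θ ψ : ℝ) :
    Complex.exp ((m * θ + n * ψ : ℝ) * Complex.I) *
      fc (fun z => mult (rot θ, rot ψ) z * f (tact (rot θ, rot ψ) z)) m n = fc f m n := by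
  unfold fc
  rw [← integral_comp_tact (rot θ, rot ψ) (fun z => (f z : ℂ) * chr m n z), ← integral_const_mul]
  refine integral_congr_ae (Filter.Eventually.of_forall fun z => ?_)
  simp only [kProd_rot, chr_tact_rot hm hn, one_pow, inv_one, one_smul]
  push_cast
  ring

theorem exp_mul_I_eq_one_iff (t : ℝ) :
    Complex.exp (t * Complex.I) = 1 ↔ ∃ k : ℤ, t = 2 * Real.pi * k := by
  rw [Complex.exp_eq_one_iff]
  refine exists_congr fun k => ?_
  constructor
  · intro h
    have := congrArg Complex.im h
    simp at this
    linarith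
  · rintro rfl
    push_cast
    ring

/-- For rotations `k = 1`, so the condition is invariance of the density under `T`, which multiplies
each odd Fourier coefficient by a phase. Invariance means that the phase is 1 wherever the
coefficient is nonzero, by completeness of the odd characters. -/
theorem rot_mem_littleGroup_iff (φ : StrongDual ℝ L2) (θ ψ : ℝ) :
    (rot θ, rot ψ) ∈ littleGroup φ ↔ ∀ m n : ℤ, Odd m → Odd n → fc (density φ) m n ≠ 0 →
      ∃ k : ℤ, m * θ + n * ψ = 2 * Real.pi * k := by
  rw [mem_littleGroup_iff]
  simp only [kProd_rot, one_pow, mul_one]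
  have hms : ∀ z, mult (rot θ, rot ψ) z * mult (rot θ, rot ψ) z = 1 := fun z => by
    exact_mod_cast mult_rot_sq θ ψ z
  constructor
  · intro h m n hm hn hc
    rw [← exp_mul_I_eq_one_iff]
    have h1 := fc_rot (f := density φ) hm hn θ ψ
    have h2 : fc (fun z => mult (rot θ, rot ψ) z * density φ (tact (rot θ, rot ψ) z)) m n =
        fc (density φ) m n := by
      unfold fc
      refine integral_congr_ae (h.mono fun z hz => ?_)
      simp only
      rw [hz, ← mul_assoc, hms, one_mul]
    rw [h2] at h1
    exact mul_right_cancel₀ hc (h1.trans (one_mul _).symm)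
  · intro h
    have h1 := memLp_T (rot θ, rot ψ) (density φ)
    have h2 := ae_eq_zero_of_fc (h1.sub (Lp.memLp (density φ))) fun m n hm hn => by
      have hi : ∀ {f : Torus → ℝ}, MemLp f 2 lam →
          Integrable (fun z => (f z : ℂ) * chr m n z) lam := fun {f} hf => by
        refine ((hf.integrable (by norm_num)).ofReal (𝕜 := ℂ)).mul_bdd (c := 1)
          (measurable_chr m n).aestronglyMeasurable
          (Filter.Eventually.of_forall fun z => (norm_chr m n z).le)
      have h3 : fc ((fun z => mult (rot θ, rot ψ) z * density φ (tact (rot θ, rot ψ) z)) -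
          density φ) m n =
          fc (fun z => mult (rot θ, rot ψ) z * density φ (tact (rot θ, rot ψ) z)) m n -
            fc (density φ) m n := by
        unfold fc
        rw [← integral_sub (hi h1) (hi (Lp.memLp _))]
        refine integral_congr_ae (Filter.Eventually.of_forall fun z => ?_)
        simp only [Pi.sub_apply]
        push_cast
        ring
      have h4 := fc_rot (f := density φ) hm hn θ ψ
      rw [h3, sub_eq_zero]
      by_cases hc : fc (density φ) m n = 0
      · rw [hc] at h4 ⊢
        exact (mul_eq_zero.1 h4).resolve_left (Complex.exp_ne_zero _)
      · rw [(exp_mul_I_eq_one_iff _).2 (h m n hm hn hc), one_mul] at h4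
        exact h4
    filter_upwards [h2] with z hz
    simp only [Pi.sub_apply, Pi.zero_apply, sub_eq_zero] at hz
    rw [← hz, ← mul_assoc, hms, one_mul]

/-! ### Subgroups of the torus that are kernels of odd characters. -/

theorem mem_torusK_iff {p : GG} : p ∈ torusK ↔ ∃ θ ψ : ℝ, p = (rot θ, rot ψ) := by
  constructor
  · rintro ⟨⟨θ, hθ⟩, ψ, hψ⟩
    exact ⟨θ, ψ, Prod.ext hθ.symm hψ.symm⟩
  · rintro ⟨θ, ψ, rfl⟩
    exact ⟨⟨θ, rfl⟩, ψ, rfl⟩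

theorem rot_mem_groupH_iff {N : ℕ} {p q : ℤ} {θ ψ : ℝ} :
    (rot θ, rot ψ) ∈ groupH N p q ↔ ∃ k : ℤ, (N : ℝ) * (p * θ + q * ψ) = 2 * Real.pi * k := by
  constructor
  · rintro ⟨θ', ψ', h, k, hk⟩
    obtain ⟨i, hi⟩ := rot_eq_rot_iff.1 (congrArg Prod.fst h)
    obtain ⟨j, hj⟩ := rot_eq_rot_iff.1 (congrArg Prod.snd h)
    refine ⟨k + N * (p * i + q * j), ?_⟩
    rw [hi, hj]
    push_cast
    linear_combination hk
  · rintro ⟨k, hk⟩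
    exact ⟨θ, ψ, rfl, k, hk⟩

theorem rot_mem_cyc {d : ℕ} (hd : 0 < d) {θ : ℝ} {k : ℤ} (h : (d : ℝ) * θ = 2 * Real.pi * k) :
    rot θ ∈ cyc d := by
  have hd' : (d : ℝ) ≠ 0 := by exact_mod_cast hd.ne'
  refine ⟨k, ?_⟩
  simp only
  rw [← rot_zpow]
  congr 1
  field_simp
  linarith

theorem finite_cyc {n : ℕ} (hn : 0 < n) : Finite (cyc n) := by
  have h : (rot (2 * Real.pi / n)) ^ n = 1 := by
    have := rot_zpow (2 * Real.pi / n) n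
    rw [zpow_natCast] at this
    rw [← this, rot_eq_one_iff]
    have : (n : ℝ) ≠ 0 := by exact_mod_cast hn.ne'
    exact ⟨1, by push_cast; field_simp⟩
  have h2 : IsOfFinOrder (rot (2 * Real.pi / n)) := isOfFinOrder_iff_pow_eq_one.2 ⟨n, hn, h⟩
  exact Nat.finite_of_card_ne_zero (by rw [cyc, Nat.card_zpowers]; exact h2.orderOf_pos.ne')

theorem finite_of_le_prod_cyc {L : Subgroup GG} {n m : ℕ} (hn : 0 < n) (hm : 0 < m)
    (h : L ≤ (cyc n).prod (cyc m)) : Finite L := by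
  have := finite_cyc hn
  have := finite_cyc hm
  have h2 : ((cyc n : Set SL2) ×ˢ (cyc m : Set SL2)).Finite :=
    (Set.toFinite _).prod (Set.toFinite _)
  exact (h2.subset h).to_subtype

theorem isClassE1_of_le {L : Subgroup GG} {d : ℕ} (hd : 0 < d) (h : L ≤ (cyc d).prod (cyc d))
    (h1 : ((-1, -1) : GG) ∈ L) (h2 : ((-1, 1) : GG) ∉ L) : IsClassE1 L := by
  refine ⟨⟨d, d, hd, hd, h⟩, ?_, h1, fun hD => h2 (hD (by simp [groupD]))⟩
  have := finite_of_le_prod_cyc hd hd h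
  have ho : orderOf (⟨(-1, -1), h1⟩ : L) = 2 := by
    refine orderOf_eq_prime ?_ ?_
    · ext1
      simp [sq]
    · intro h0
      have h3 : ((-1 : SL2), (-1 : SL2)) = 1 := congrArg Subtype.val h0
      have h4 : (-1 : SL2).1 0 0 = (1 : SL2).1 0 0 :=
        congrArg (fun p : GG => p.1.1 0 0) h3
      norm_num at h4
  rw [even_iff_two_dvd]
  have := orderOf_dvd_natCard (⟨(-1, -1), h1⟩ : L)
  rwa [ho] at this

theorem exists_natAbs_mul_eq_iff {N : ℤ} {t : ℝ} :
    (∃ j : ℤ, (N.natAbs : ℝ) * t = 2 * Real.pi * j) ↔ ∃ j : ℤ, (N : ℝ) * t = 2 * Real.pi * j := by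
  rcases Int.natAbs_eq N with h | h
  · have h' := congrArg (Int.cast : ℤ → ℝ) h
    rw [Int.cast_natCast] at h'
    rw [← h']
  · have h' := congrArg (Int.cast : ℤ → ℝ) h
    rw [Int.cast_neg, Int.cast_natCast] at h'
    rw [h']
    constructor <;> rintro ⟨j, hj⟩ <;> exact ⟨-j, by push_cast; linarith⟩

/-- The subgroups of the torus cut out by a nonempty set of characters with odd exponents. -/
theorem classE1_or_groupH {L : Subgroup GG} (hL : L ≤ torusK) {S : Set (ℤ × ℤ)}
    (hS : S.Nonempty) (hodd : ∀ a ∈ S, Odd a.1 ∧ Odd a.2)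
    (hmem : ∀ θ ψ : ℝ, (rot θ, rot ψ) ∈ L ↔
      ∀ a ∈ S, ∃ k : ℤ, a.1 * θ + a.2 * ψ = 2 * Real.pi * k) :
    IsClassE1 L ∨ ∃ (N : ℕ) (p q : ℤ), Odd N ∧ Odd p ∧ Odd q ∧ IsCoprime p q ∧
      L = groupH N p q := by
  obtain ⟨a, ha⟩ := hS
  obtain ⟨ha1, ha2⟩ := hodd a ha
  -- Either all characters in `S` are proportional to `a`, or some `b` in `S` is independent of it.
  by_cases hprop : ∀ b ∈ S, b.1 * a.2 = b.2 * a.1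
  · right
    have ha10 : a.1 ≠ 0 := fun h => by simp [h] at ha1
    set g : ℕ := Int.gcd a.1 a.2 with hg
    have hg0 : 0 < g := Int.gcd_pos_of_ne_zero_left _ ha10
    obtain ⟨p, hp⟩ : (g : ℤ) ∣ a.1 := Int.gcd_dvd_left ..
    obtain ⟨q, hq⟩ : (g : ℤ) ∣ a.2 := Int.gcd_dvd_right ..
    have hg0' : (g : ℤ) ≠ 0 := by exact_mod_cast hg0.ne'
    have hpq : IsCoprime p q := by
      rw [Int.isCoprime_iff_gcd_eq_one]
      have h := hg
      rw [hp, hq, Int.gcd_mul_left, Int.natAbs_natCast] at h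
      exact Nat.eq_of_mul_eq_mul_left hg0 (by rw [mul_one]; exact h.symm)
    have hpo : Odd p := (Int.odd_mul.1 (hp ▸ ha1)).2
    have hqo : Odd q := (Int.odd_mul.1 (hq ▸ ha2)).2
    have hgo : Odd (g : ℤ) := (Int.odd_mul.1 (hp ▸ ha1)).1
    have hp0 : p ≠ 0 := fun h => by simp [h] at hpo
    have hmul : ∀ b ∈ S, ∃ k : ℤ, b = (k * p, k * q) := fun b hb => by
      have h1 : b.1 * q = b.2 * p := by
        have := hprop b hb
        rw [hp, hq] at this
        refine mul_left_cancel₀ hg0' ?_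
        linear_combination this
      obtain ⟨k, hk⟩ : p ∣ b.1 := hpq.dvd_of_dvd_mul_right ⟨b.2, by rw [h1]; ring⟩
      refine ⟨k, Prod.ext (by simpa [mul_comm] using hk) ?_⟩
      refine mul_right_cancel₀ hp0 ?_
      simp only
      rw [← h1, hk]; ring
    -- All of `S` consists of multiples `k (p, q)` of one primitive vector, and `N` generates the
    -- group spanned by these `k`. It is odd because it divides the odd gcd of the entries of `a`.
    obtain ⟨N, hN⟩ := Int.subgroup_cyclic (AddSubgroup.closure {k : ℤ | (k * p, k * q) ∈ S})
    have hNdvd : ∀ k : ℤ, (k * p, k * q) ∈ S → N ∣ k := fun k hk => by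
      have h1 : k ∈ AddSubgroup.closure {k : ℤ | (k * p, k * q) ∈ S} :=
        AddSubgroup.subset_closure hk
      rw [hN, AddSubgroup.mem_closure_singleton] at h1
      obtain ⟨j, hj⟩ := h1
      exact ⟨j, by rw [← hj, smul_eq_mul, mul_comm]⟩
    have hNo : Odd N := by
      obtain ⟨j, hj⟩ := hNdvd g (by rw [← hp, ← hq]; exact ha)
      exact (Int.odd_mul.1 (hj ▸ hgo)).1
    refine ⟨N.natAbs, p, q, Int.natAbs_odd.2 hNo, hpo, hqo, hpq, ?_⟩
    have hiff : ∀ t : ℝ, (∀ k : ℤ, (k * p, k * q) ∈ S → ∃ j : ℤ, k * t = 2 * Real.pi * j) ↔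
        ∃ j : ℤ, (N.natAbs : ℝ) * t = 2 * Real.pi * j := fun t => by
      have hab : (∃ j : ℤ, (N.natAbs : ℝ) * t = 2 * Real.pi * j) ↔
          ∃ j : ℤ, (N : ℝ) * t = 2 * Real.pi * j := exists_natAbs_mul_eq_iff
      rw [hab]
      constructor
      · intro h
        let A : AddSubgroup ℤ :=
          { carrier := {k : ℤ | ∃ j : ℤ, (k : ℝ) * t = 2 * Real.pi * j}
            zero_mem' := ⟨0, by simp⟩
            add_mem' := by
              rintro x y ⟨i, hi⟩ ⟨j, hj⟩
              exact ⟨i + j, by push_cast; linear_combination hi + hj⟩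
            neg_mem' := by
              rintro x ⟨i, hi⟩
              exact ⟨-i, by push_cast; linear_combination -hi⟩ }
        have h1 : AddSubgroup.closure {k : ℤ | (k * p, k * q) ∈ S} ≤ A :=
          (AddSubgroup.closure_le _).2 h
        exact h1 (hN ▸ AddSubgroup.mem_closure_singleton.2 ⟨1, one_smul _ _⟩)
      · rintro ⟨j, hj⟩ k hk
        obtain ⟨i, rfl⟩ := hNdvd k hk
        exact ⟨i * j, by push_cast; linear_combination (i : ℝ) * hj⟩
    have hLH : ∀ θ ψ : ℝ, (rot θ, rot ψ) ∈ L ↔ (rot θ, rot ψ) ∈ groupH N.natAbs p q := by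
      intro θ ψ
      rw [hmem, rot_mem_groupH_iff, ← hiff]
      constructor
      · intro h k hk
        obtain ⟨j, hj⟩ := h _ hk
        refine ⟨j, ?_⟩
        rw [← hj]
        push_cast
        ring
      · intro h b hb
        obtain ⟨k, rfl⟩ := hmul b hb
        obtain ⟨j, hj⟩ := h k hb
        refine ⟨j, ?_⟩
        rw [← hj]
        push_cast
        ring
    ext x
    constructor
    · intro hx
      obtain ⟨θ, ψ, rfl⟩ := mem_torusK_iff.1 (hL hx)
      exact (hLH θ ψ).1 hx
    · rintro ⟨θ, ψ, rfl, k, hk⟩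
      exact (hLH θ ψ).2 ⟨θ, ψ, rfl, k, hk⟩
  · left
    push Not at hprop
    obtain ⟨b, hb, hne⟩ := hprop
    have hd0 : b.1 * a.2 - b.2 * a.1 ≠ 0 := sub_ne_zero.2 hne
    have hd : 0 < (b.1 * a.2 - b.2 * a.1).natAbs := Int.natAbs_pos.2 hd0
    -- Cramer's rule for the two congruences bounds the orders of both angles by the determinant of
    -- the two characters.
    refine isClassE1_of_le hd ?_ ?_ ?_
    · intro x hx
      obtain ⟨θ, ψ, rfl⟩ := mem_torusK_iff.1 (hL hx)
      obtain ⟨i, hi⟩ := (hmem θ ψ).1 hx a ha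
      obtain ⟨j, hj⟩ := (hmem θ ψ).1 hx b hb
      have h1 : ((b.1 * a.2 - b.2 * a.1 : ℤ) : ℝ) * θ =
          2 * Real.pi * (a.2 * j - b.2 * i : ℤ) := by
        push_cast
        linear_combination (a.2 : ℝ) * hj - b.2 * hi
      have h2 : ((b.1 * a.2 - b.2 * a.1 : ℤ) : ℝ) * ψ =
          2 * Real.pi * (b.1 * i - a.1 * j : ℤ) := by
        push_cast
        linear_combination (b.1 : ℝ) * hi - a.1 * hj
      obtain ⟨k, hk⟩ := exists_natAbs_mul_eq_iff.2 ⟨_, h1⟩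
      obtain ⟨k', hk'⟩ := exists_natAbs_mul_eq_iff.2 ⟨_, h2⟩
      exact ⟨rot_mem_cyc hd hk, rot_mem_cyc hd hk'⟩
    · rw [← rot_pi, hmem]
      intro b hb
      obtain ⟨k, hk⟩ := (hodd b hb).1.add_odd (hodd b hb).2
      refine ⟨k, ?_⟩
      have : (b.1 + b.2 : ℝ) = k + k := by exact_mod_cast hk
      linear_combination Real.pi * this
    -- At `(-I, I)` the character `a` has phase `a.1 π`, an odd multiple of `π`.
    · rw [← rot_pi, ← rot_zero, hmem]
      intro h
      obtain ⟨k, hk⟩ := h a ha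
      have h1 : Real.pi * (a.1 : ℝ) = Real.pi * (2 * k) := by linear_combination hk
      have h2 : (a.1 : ℝ) = 2 * k := mul_left_cancel₀ Real.pi_ne_zero h1
      have h3 : a.1 = 2 * k := by exact_mod_cast h2
      rw [h3] at ha1
      simp [Int.odd_mul] at ha1
      exact absurd ha1.1 (by decide)

theorem littleGroup_classE1_or_groupH {φ : StrongDual ℝ L2} (hφ : φ ≠ 0)
    (hL : littleGroup φ ≤ torusK) :
    IsClassE1 (littleGroup φ) ∨ ∃ (N : ℕ) (p q : ℤ), Odd N ∧ Odd p ∧ Odd q ∧ IsCoprime p q ∧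
      littleGroup φ = groupH N p q := by
  refine classE1_or_groupH hL
    (S := {a : ℤ × ℤ | Odd a.1 ∧ Odd a.2 ∧ fc (density φ) a.1 a.2 ≠ 0}) ?_
    (fun a ha => ⟨ha.1, ha.2.1⟩) fun θ ψ => ?_
  · by_contra hne
    rw [Set.not_nonempty_iff_eq_empty] at hne
    refine density_ne_zero hφ (ae_eq_zero_of_fc (Lp.memLp _) fun m n hm hn => ?_)
    by_contra hc
    have : ((m, n) : ℤ × ℤ) ∈ (∅ : Set (ℤ × ℤ)) := hne ▸ ⟨hm, hn, hc⟩
    exact this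
  · rw [rot_mem_littleGroup_iff]
    exact ⟨fun h a ha => h a.1 a.2 ha.1 ha.2.1 ha.2.2,
      fun h m n hm hn hc => h (m, n) ⟨hm, hn, hc⟩⟩

/-! ### Conjugation of little groups. -/

theorem littleGroup_dualAction (g : GG) (φ : StrongDual ℝ L2) :
    littleGroup (dualAction g φ) = (littleGroup φ).map (MulAut.conj g).toMonoidHom := by
  ext p
  rw [Subgroup.mem_map]
  have key : ∀ x, dualAction (g * x * g⁻¹) (dualAction g φ) = dualAction g (dualAction x φ) := by
    intro x
    rw [← dualAction_mul, ← dualAction_mul, inv_mul_cancel_right]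
  constructor
  · intro hp
    refine ⟨g⁻¹ * p * g, ?_, by simp [MulAut.conj_apply, mul_assoc]⟩
    change dualAction _ φ = φ
    rw [dualAction_mul, dualAction_mul, show dualAction p (dualAction g φ) = dualAction g φ from hp,
      ← dualAction_mul, inv_mul_cancel, dualAction_one]
  · rintro ⟨x, hx, rfl⟩
    change dualAction (g * x * g⁻¹) (dualAction g φ) = dualAction g φ
    rw [key, show dualAction x φ = φ from hx]

theorem dualAction_ne_zero (g : GG) {φ : StrongDual ℝ L2} (hφ : φ ≠ 0) : dualAction g φ ≠ 0 := by
  intro h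
  apply hφ
  have h1 := congrArg (dualAction g⁻¹) h
  rw [← dualAction_mul, inv_mul_cancel, dualAction_one] at h1
  rw [h1]
  ext α
  rfl

theorem exists_conj_classE1_or_groupH {L : Subgroup GG} (hL : IsActualLittleGroup L) :
    ∃ g : GG, IsClassE1 (L.map (MulAut.conj g).toMonoidHom) ∨
      ∃ (N : ℕ) (p q : ℤ), Odd N ∧ Odd p ∧ Odd q ∧ IsCoprime p q ∧
        L.map (MulAut.conj g).toMonoidHom = groupH N p q := by
  obtain ⟨φ, hφ, rfl⟩ := hL
  obtain ⟨g, hg⟩ := exists_conj_le_torusK hφ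
  refine ⟨g, ?_⟩
  rw [← littleGroup_dualAction]
  refine littleGroup_classE1_or_groupH (dualAction_ne_zero g hφ) ?_
  rw [littleGroup_dualAction]
  rintro _ ⟨x, hx, rfl⟩
  exact hg x hx

/-! ### The dimension of finite groups and of the groups `H(N, p, q)`. -/

theorem hasDerivAt_exp_smul_entry (X : Matrix (Fin 2) (Fin 2) ℝ) (t : ℝ) (i j : Fin 2) :
    HasDerivAt (fun t : ℝ => (NormedSpace.exp (t • X) : Matrix (Fin 2) (Fin 2) ℝ) i j)
      (((NormedSpace.exp (t • X) : Matrix (Fin 2) (Fin 2) ℝ) * X) i j) t := by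
  let _ : NormedRing (Matrix (Fin 2) (Fin 2) ℝ) := Matrix.linftyOpNormedRing
  let _ : NormedAlgebra ℝ (Matrix (Fin 2) (Fin 2) ℝ) := Matrix.linftyOpNormedAlgebra
  have h := hasDerivAt_exp_smul_const (𝕂 := ℝ) X t
  let e : Matrix (Fin 2) (Fin 2) ℝ →L[ℝ] ℝ :=
    LinearMap.toContinuousLinearMap (Matrix.entryLinearMap ℝ ℝ i j)
  exact e.hasFDerivAt.comp_hasDerivAt t h

theorem hasDerivAt_exp_smul_entry_zero (X : Matrix (Fin 2) (Fin 2) ℝ) (i j : Fin 2) :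
    HasDerivAt (fun t : ℝ => (NormedSpace.exp (t • X) : Matrix (Fin 2) (Fin 2) ℝ) i j)
      (X i j) 0 := by
  simpa using hasDerivAt_exp_smul_entry X 0 i j

theorem eq_zero_of_finite_range_exp {X : Matrix (Fin 2) (Fin 2) ℝ}
    (h : (Set.range fun t : ℝ => (NormedSpace.exp (t • X) : Matrix (Fin 2) (Fin 2) ℝ)).Finite) :
    X = 0 := by
  ext i j
  set f : ℝ → ℝ := fun t => (NormedSpace.exp (t • X) : Matrix (Fin 2) (Fin 2) ℝ) i j with hf
  have hfin : (Set.range f).Finite := by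
    have : Set.range f = (fun M : Matrix (Fin 2) (Fin 2) ℝ => M i j) ''
        (Set.range fun t : ℝ => (NormedSpace.exp (t • X) : Matrix (Fin 2) (Fin 2) ℝ)) := by
      rw [← Set.range_comp]; rfl
    rw [this]
    exact h.image _
  have hc : Continuous f := continuous_iff_continuousAt.2 fun t =>
    (hasDerivAt_exp_smul_entry X t i j).continuousAt
  -- A continuous function on the line with finite range is constant; its derivative at 0 is the
  -- entry of `X`.
  have hconst : f = fun _ => f 0 := funext fun t =>
    isPreconnected_univ.constant_of_mapsTo hfin.isDiscrete hc.continuousOn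
      (fun s _ => Set.mem_range_self s) trivial trivial
  have hd : HasDerivAt f (X i j) 0 := hasDerivAt_exp_smul_entry_zero X i j
  rw [hconst] at hd
  exact hd.unique (hasDerivAt_const _ _)

theorem lieDim_eq_zero_of_finite {L : Subgroup GG} (hL : Finite L) : lieDim L = 0 := by
  have h0 : lieSet L ⊆ {0} := by
    intro X hX
    choose p hp h1 h2 using hX
    have hfin : (L : Set GG).Finite := Set.toFinite _
    refine Prod.ext ?_ ?_
    · refine eq_zero_of_finite_range_exp ((hfin.image fun p => p.1.1).subset ?_)
      rintro _ ⟨t, rfl⟩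
      exact ⟨p t, hp t, h1 t⟩
    · refine eq_zero_of_finite_range_exp ((hfin.image fun p => p.2.1).subset ?_)
      rintro _ ⟨t, rfl⟩
      exact ⟨p t, hp t, h2 t⟩
  have h1 : Submodule.span ℝ (lieSet L) = ⊥ := by
    rw [eq_bot_iff, Submodule.span_le]
    exact fun X hX => by simpa using h0 hX
  rw [lieDim, h1, finrank_bot]

/-- Simultaneous conjugation of pairs of matrices. -/
def conjPair (g : GG) : (Matrix (Fin 2) (Fin 2) ℝ × Matrix (Fin 2) (Fin 2) ℝ) →ₗ[ℝ]
    (Matrix (Fin 2) (Fin 2) ℝ × Matrix (Fin 2) (Fin 2) ℝ) where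
  toFun X := (g.1.1 * X.1 * (g⁻¹).1.1, g.2.1 * X.2 * (g⁻¹).2.1)
  map_add' X Y := by simp [mul_add, add_mul]
  map_smul' c X := by simp

theorem coe_mul_inv (g : SL2) : g.1 * (g⁻¹).1 = 1 := congrArg Subtype.val (mul_inv_cancel g)

theorem coe_inv_mul (g : SL2) : (g⁻¹).1 * g.1 = 1 := congrArg Subtype.val (inv_mul_cancel g)

theorem conjPair_inv (g : GG) (X) : conjPair g⁻¹ (conjPair g X) = X := by
  have h : ∀ (g : SL2) (M : Matrix (Fin 2) (Fin 2) ℝ), (g⁻¹).1 * (g.1 * M * (g⁻¹).1) * g.1 = M :=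
    fun g M => by
      rw [← mul_assoc, ← mul_assoc, coe_inv_mul, one_mul, mul_assoc, coe_inv_mul, mul_one]
  refine Prod.ext ?_ ?_
  · simpa [conjPair] using h g.1 X.1
  · simpa [conjPair] using h g.2 X.2

/-- The matrix exponential commutes with conjugation. -/
theorem conjPair_mem_lieSet {L : Subgroup GG} (g : GG) {X} (hX : X ∈ lieSet L) :
    conjPair g X ∈ lieSet (L.map (MulAut.conj g).toMonoidHom) := by
  have h : ∀ (g : SL2) (M : Matrix (Fin 2) (Fin 2) ℝ) (t : ℝ),
      NormedSpace.exp (t • (g.1 * M * (g⁻¹).1)) = g.1 * NormedSpace.exp (t • M) * (g⁻¹).1 := by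
    intro g M t
    have h1 : (g⁻¹).1 = (g.1)⁻¹ := (Matrix.inv_eq_right_inv (coe_mul_inv g)).symm
    rw [h1, ← Matrix.exp_conj _ _ (IsUnit.of_mul_eq_one _ (coe_mul_inv g))]
    simp
  intro t
  obtain ⟨p, hp, h1, h2⟩ := hX t
  refine ⟨g * p * g⁻¹, ⟨p, hp, rfl⟩, ?_, ?_⟩
  · exact ((h g.1 X.1 t).trans (by rw [← h1]; rfl)).symm
  · exact ((h g.2 X.2 t).trans (by rw [← h2]; rfl)).symm

theorem map_conj_inv (L : Subgroup GG) (g : GG) :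
    (L.map (MulAut.conj g).toMonoidHom).map (MulAut.conj g⁻¹).toMonoidHom = L := by
  rw [Subgroup.map_map]
  convert Subgroup.map_id L
  ext x : 1
  simp [mul_assoc]

theorem lieDim_map_conj (L : Subgroup GG) (g : GG) :
    lieDim (L.map (MulAut.conj g).toMonoidHom) = lieDim L := by
  have hinj : ∀ g : GG, Function.Injective (conjPair g) := fun g =>
    Function.LeftInverse.injective (conjPair_inv g)
  have hle : ∀ (L : Subgroup GG) (g : GG),
      lieDim L ≤ lieDim (L.map (MulAut.conj g).toMonoidHom) := by
    intro L g
    unfold lieDim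
    rw [(Submodule.equivMapOfInjective _ (hinj g) (Submodule.span ℝ (lieSet L))).finrank_eq]
    refine Submodule.finrank_mono ?_
    rw [Submodule.map_span]
    refine Submodule.span_mono ?_
    rintro _ ⟨X, hX, rfl⟩
    exact conjPair_mem_lieSet g hX
  refine le_antisymm ?_ (hle L g)
  have := hle (L.map (MulAut.conj g).toMonoidHom) g⁻¹
  rwa [map_conj_inv] at this

/-- The infinitesimal generator of the rotations. -/
def rotGen : Matrix (Fin 2) (Fin 2) ℝ := !![0, 1; -1, 0]

theorem exp_smul_rotGen (θ : ℝ) :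
    (NormedSpace.exp (θ • rotGen) : Matrix (Fin 2) (Fin 2) ℝ) = (rot θ).1 := by
  have hJ : rotGen * rotGen = -1 := by
    ext i j
    fin_cases i <;> fin_cases j <;> simp [rotGen, Matrix.mul_apply, Fin.sum_univ_two]
  -- Since `rotGen` squares to `-1`, it is the image of `i` under an algebra map from `ℂ`, which
  -- carries Euler's formula over to matrices.
  let F : ℂ →ₐ[ℝ] Matrix (Fin 2) (Fin 2) ℝ := Complex.lift ⟨rotGen, hJ⟩
  have hF : ∀ z, F z = z.re • 1 + z.im • rotGen := fun z => by
    simp [F, Complex.liftAux_apply, Algebra.algebraMap_eq_smul_one]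
  have hc : Continuous F := LinearMap.continuous_of_finiteDimensional F.toLinearMap
  have h : F (NormedSpace.exp (θ * Complex.I : ℂ)) = NormedSpace.exp (F (θ * Complex.I)) :=
    let _ : NormedRing (Matrix (Fin 2) (Fin 2) ℝ) := Matrix.linftyOpNormedRing
    let _ : NormedAlgebra ℝ (Matrix (Fin 2) (Fin 2) ℝ) := Matrix.linftyOpNormedAlgebra
    NormedSpace.map_exp F hc (θ * Complex.I)
  have h1 : F (θ * Complex.I) = θ • rotGen := by
    rw [hF]; simp
  rw [h1, ← Complex.exp_eq_exp_ℂ, hF, Complex.exp_ofReal_mul_I_re,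
    Complex.exp_ofReal_mul_I_im] at h
  rw [← h]
  ext i j
  fin_cases i <;> fin_cases j <;> simp [rotGen, rot]

/-- Differentiating at 0 the relations between the entries of a rotation gives the linear equations
of its Lie algebra; `cos² + sin² = 1` yields the vanishing of the diagonal. -/
theorem eq_smul_rotGen_of_exp {X : Matrix (Fin 2) (Fin 2) ℝ}
    (h : ∀ t : ℝ, ∃ θ : ℝ, (rot θ).1 = NormedSpace.exp (t • X)) : ∃ a : ℝ, X = a • rotGen := by
  have hd := hasDerivAt_exp_smul_entry_zero X
  have e1 : X 1 1 = X 0 0 := by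
    refine (hd 1 1).unique ((hd 0 0).congr_of_eventuallyEq (Filter.Eventually.of_forall ?_))
    intro t
    obtain ⟨θ, hθ⟩ := h t
    simp [← hθ, rot]
  have e2 : X 1 0 = -X 0 1 := by
    refine (hd 1 0).unique ((hd 0 1).neg.congr_of_eventuallyEq (Filter.Eventually.of_forall ?_))
    intro t
    obtain ⟨θ, hθ⟩ := h t
    simp [← hθ, rot]
  have e3 : 2 * X 0 0 = 0 := by
    have h1 := ((hd 0 0).mul (hd 0 0)).add ((hd 0 1).mul (hd 0 1))
    have h2 : HasDerivAt (fun _ : ℝ => (1 : ℝ)) 0 0 := hasDerivAt_const _ _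
    have h3 := h1.unique (h2.congr_of_eventuallyEq (Filter.Eventually.of_forall fun t => by
      obtain ⟨θ, hθ⟩ := h t
      simp only [Pi.add_apply, Pi.mul_apply, ← hθ, rot, Matrix.of_apply, Matrix.cons_val_zero,
        Matrix.cons_val_one, Matrix.cons_val', Matrix.cons_val_fin_one]
      nlinarith [Real.cos_sq_add_sin_sq θ]))
    simp at h3
    linarith
  refine ⟨X 0 1, ?_⟩
  ext i j
  fin_cases i <;> fin_cases j <;> simp [rotGen, e1, e2] <;> linarith

theorem lieSet_groupH {N : ℕ} {p q : ℤ} (hN : N ≠ 0) (hq : q ≠ 0) :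
    lieSet (groupH N p q) =
      Set.range fun c : ℝ => c • (((q : ℝ) • rotGen, -(p : ℝ) • rotGen) :
        Matrix (Fin 2) (Fin 2) ℝ × Matrix (Fin 2) (Fin 2) ℝ) := by
  have hq' : (q : ℝ) ≠ 0 := by exact_mod_cast hq
  have hN' : (N : ℝ) ≠ 0 := by exact_mod_cast hN
  ext X
  constructor
  · intro hX
    obtain ⟨a, ha⟩ : ∃ a : ℝ, X.1 = a • rotGen := eq_smul_rotGen_of_exp fun t => by
      obtain ⟨_, ⟨θ, ψ, rfl, -⟩, h1, -⟩ := hX t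
      exact ⟨θ, h1⟩
    obtain ⟨b, hb⟩ : ∃ b : ℝ, X.2 = b • rotGen := eq_smul_rotGen_of_exp fun t => by
      obtain ⟨_, ⟨θ, ψ, rfl, -⟩, -, h2⟩ := hX t
      exact ⟨ψ, h2⟩
    have hmem : ∀ t : ℝ, ∃ k : ℤ, (N : ℝ) * (p * a + q * b) * t = 2 * Real.pi * k := by
      intro t
      obtain ⟨x, hx, h1, h2⟩ := hX t
      rw [ha, smul_smul, exp_smul_rotGen] at h1
      rw [hb, smul_smul, exp_smul_rotGen] at h2
      have hx' : x = (rot (t * a), rot (t * b)) := Prod.ext (Subtype.ext h1) (Subtype.ext h2)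
      rw [hx', rot_mem_groupH_iff] at hx
      obtain ⟨k, hk⟩ := hx
      exact ⟨k, by rw [← hk]; ring⟩
    have hab : p * a + q * b = 0 := by
      by_contra hne
      set c := (N : ℝ) * (p * a + q * b)
      have hc : c ≠ 0 := mul_ne_zero hN' hne
      -- A nonzero slope `c` would reach the value `π`, which is not in `2πℤ`.
      obtain ⟨k, hk⟩ := hmem (Real.pi / c)
      rw [mul_div_cancel₀ _ hc] at hk
      have h1 : (2 * k : ℝ) = 1 := by
        refine mul_left_cancel₀ Real.pi_ne_zero ?_
        linarith
      have h2 : 2 * k = 1 := by exact_mod_cast h1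
      omega
    refine ⟨a / q, Prod.ext ?_ ?_⟩
    · simp only [Prod.smul_mk, smul_smul]
      rw [ha]
      congr 1
      field_simp
    · simp only [Prod.smul_mk, smul_smul]
      rw [hb]
      congr 1
      field_simp
      linarith
  · rintro ⟨c, rfl⟩ t
    refine ⟨(rot (t * (c * q)), rot (t * (c * -p))), ⟨_, _, rfl, 0, by push_cast; ring⟩, ?_, ?_⟩
    · simp only [Prod.smul_mk, smul_smul, exp_smul_rotGen]
    · simp only [Prod.smul_mk, smul_smul, exp_smul_rotGen]

theorem lieDim_groupH {N : ℕ} {p q : ℤ} (hN : N ≠ 0) (hq : q ≠ 0) :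
    lieDim (groupH N p q) = 1 := by
  set v : Matrix (Fin 2) (Fin 2) ℝ × Matrix (Fin 2) (Fin 2) ℝ :=
    ((q : ℝ) • rotGen, -(p : ℝ) • rotGen) with hv
  have hv0 : v ≠ 0 := by
    intro h
    have h1 : ((q : ℝ) • rotGen) 0 1 = (0 : Matrix (Fin 2) (Fin 2) ℝ) 0 1 := by
      rw [show (q : ℝ) • rotGen = v.1 from rfl, h]; rfl
    simp [rotGen] at h1
    exact hq h1
  have hspan : Submodule.span ℝ (lieSet (groupH N p q)) = Submodule.span ℝ {v} := by
    rw [lieSet_groupH hN hq]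
    have : (Set.range fun c : ℝ => c • v) = (Submodule.span ℝ {v} : Set _) := by
      ext x
      simp [Submodule.mem_span_singleton]
    rw [← hv, this, Submodule.span_eq]
  rw [lieDim, hspan, finrank_span_singleton hv0]

/-- The group contains the one-parameter subgroup `t ↦ (R(qt), R(-pt))`, whose first component does
not have finite range. -/
theorem infinite_groupH {N : ℕ} {p q : ℤ} (hq : q ≠ 0) : Infinite (groupH N p q) := by
  have hq' : (q : ℝ) ≠ 0 := by exact_mod_cast hq
  let f : ℝ → groupH N p q := fun t =>
    ⟨(rot (q * t), rot (-p * t)), ⟨_, _, rfl, 0, by push_cast; ring⟩⟩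
  by_contra hfin
  rw [not_infinite_iff_finite] at hfin
  have h1 : (Set.range fun t : ℝ =>
      (NormedSpace.exp (t • ((q : ℝ) • rotGen)) : Matrix (Fin 2) (Fin 2) ℝ)).Finite := by
    refine ((Set.toFinite (Set.univ : Set (groupH N p q))).image fun x => x.1.1.1).subset ?_
    rintro _ ⟨t, rfl⟩
    refine ⟨f t, trivial, ?_⟩
    simp only [smul_smul, exp_smul_rotGen, f]
    rw [mul_comm]
  have h2 := congrFun (congrFun (eq_zero_of_finite_range_exp h1) 0) 1
  simp [rotGen] at h2
  exact hq h2

/-! ### Step functionals with a prescribed stabilizer. -/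

theorem mem_littleGroup_ofDensity_iff {F : Torus → ℝ} (hF : MemLp F 2 lam) (p : GG) :
    p ∈ littleGroup (ofDensity hF.toLp) ↔
      ∀ᵐ z ∂lam, F (tact p z) = mult p z * kProd p z ^ 2 * F z := by
  rw [mem_littleGroup_iff, density_ofDensity]
  have h1 := hF.coeFn_toLp
  have h2 := (quasiMeasurePreserving_tact p).ae h1
  constructor <;> intro h <;> filter_upwards [h, h1, h2] with z hz hz1 hz2
  · rw [← hz1, ← hz2, hz]
  · rw [hz1, hz2, hz]

theorem quadratic_coeff_eq_zero {a b c : ℝ} (h : {x : ℝ | a * x ^ 2 + b * x + c = 0}.Infinite) :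
    a = 0 ∧ b = 0 ∧ c = 0 := by
  have hP0 : Polynomial.C a * Polynomial.X ^ 2 + Polynomial.C b * Polynomial.X +
      Polynomial.C c = 0 :=
    Polynomial.eq_zero_of_infinite_isRoot _ (h.mono fun x hx => by simpa using hx)
  have hcoeff := fun n => congrArg (fun p => Polynomial.coeff p n) hP0
  exact ⟨by simpa [Polynomial.coeff_X, Polynomial.coeff_C] using hcoeff 2,
    by simpa [Polynomial.coeff_X, Polynomial.coeff_C] using hcoeff 1,
    by simpa [Polynomial.coeff_X, Polynomial.coeff_C] using hcoeff 0⟩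

/-- The elements of `SL(2, ℝ)` whose factor `k_g` takes almost everywhere finitely many values. -/
theorem mem_SO2_of_ae_kFac_mem {g : SL2} {T : Set ℝ} (hT : T.Finite)
    (h : ∀ᵐ x ∂lam1, kFac g x ∈ T) : g ∈ SO2 := by
  rw [ae_lam1_iff] at h
  obtain ⟨c, -, hc⟩ : ∃ c ∈ T, {x : ℝ | kFac g (x : PLine) = c}.Infinite := by
    by_contra hcon
    push Not at hcon
    have h1 : (⋃ c ∈ T, {x : ℝ | kFac g (x : PLine) = c}).Finite :=
      hT.biUnion fun c hc => hcon c hc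
    have h2 : ∀ᵐ x : ℝ, x ∉ ⋃ c ∈ T, {x : ℝ | kFac g (x : PLine) = c} :=
      h1.countable.ae_notMem volume
    obtain ⟨x, hx, hx'⟩ := (h.and h2).exists
    exact hx' (Set.mem_biUnion hx rfl)
  -- Some value `c` is taken infinitely often, so `|row g x|² = c² (1 + x²)` is a polynomial
  -- identity: the rows of `g` are orthogonal of length `|c|`. Determinant one then gives `c² = 1`.
  obtain ⟨c2, c1, c0⟩ := quadratic_coeff_eq_zero (a := g.1 0 1 ^ 2 + g.1 0 0 ^ 2 - c ^ 2)
    (b := 2 * (g.1 0 1 * g.1 1 1 + g.1 0 0 * g.1 1 0)) (c := g.1 1 1 ^ 2 + g.1 1 0 ^ 2 - c ^ 2)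
    (hc.mono fun x hx => by
      have h1 : kFac g (x : PLine) ^ 2 = c ^ 2 := by rw [show kFac g (x : PLine) = c from hx]
      rw [kFac_coe, Real.sq_sqrt (by positivity), div_eq_iff (by positivity)] at h1
      simp only [Set.mem_ofPred_eq]
      linear_combination h1)
  have hd := det_eq_one g
  have hc4 : (c ^ 2) ^ 2 = 1 := by
    linear_combination (g.1 0 0 * g.1 1 1 - g.1 0 1 * g.1 1 0 + 1) * hd +
      (g.1 0 1 * g.1 1 1 + g.1 0 0 * g.1 1 0) / 2 * c1 - (g.1 1 1 ^ 2 + g.1 1 0 ^ 2) * c2 -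
      c ^ 2 * c0
  have hc2 : c ^ 2 = 1 := by nlinarith [sq_nonneg c]
  have hsq : (g.1 1 1 - g.1 0 0) ^ 2 + (g.1 1 0 + g.1 0 1) ^ 2 = 0 := by
    linear_combination c2 + c0 - 2 * hd + 2 * hc2
  have e1 : (g.1 1 1 - g.1 0 0) ^ 2 = 0 := by nlinarith [sq_nonneg (g.1 1 0 + g.1 0 1)]
  have e2 : (g.1 1 0 + g.1 0 1) ^ 2 = 0 := by nlinarith [sq_nonneg (g.1 1 1 - g.1 0 0)]
  exact mem_SO2_of_entries (sub_eq_zero.1 (pow_eq_zero_iff two_ne_zero |>.1 e1))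
    (eq_neg_of_add_eq_zero_left (pow_eq_zero_iff two_ne_zero |>.1 e2))

/-- The sign of the real part of a nonzero complex number, or of its imaginary part if the real
part vanishes. -/
def sgn (ω : ℂ) : ℝ := lead ![ω.im, ω.re] / |lead ![ω.im, ω.re]|

theorem lead_im_re_ne_zero {ω : ℂ} (h : ω ≠ 0) : lead ![ω.im, ω.re] ≠ 0 :=
  lead_ne_zero fun h0 => h (Complex.ext (by simpa using congrFun h0 1)
    (by simpa using congrFun h0 0))

theorem sgn_eq_or {ω : ℂ} (h : ω ≠ 0) : sgn ω = 1 ∨ sgn ω = -1 := by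
  rcases lt_or_gt_of_ne (lead_im_re_ne_zero h) with h1 | h1
  · right; rw [sgn, abs_of_neg h1, div_neg, div_self h1.ne]
  · left; rw [sgn, abs_of_pos h1, div_self h1.ne']

theorem sgn_of_re_pos {ω : ℂ} (h : 0 < ω.re) : sgn ω = 1 := by
  simp [sgn, lead, h.ne', abs_of_pos h]

theorem sgn_of_re_neg {ω : ℂ} (h : ω.re < 0) : sgn ω = -1 := by
  simp [sgn, lead, h.ne, abs_of_neg h]

theorem sgn_real_mul {s : ℝ} (hs : s * s = 1) (ω : ℂ) : sgn (s * ω) = s * sgn ω := by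
  have hs0 : s ≠ 0 := fun h => by simp [h] at hs
  have h1 : ![((s : ℂ) * ω).im, ((s : ℂ) * ω).re] = s • ![ω.im, ω.re] := by
    ext i; fin_cases i <;> simp
  have h2 : |s| = 1 := by
    have h3 := abs_mul_abs_self s
    rw [hs] at h3
    nlinarith [abs_nonneg s]
  rw [sgn, sgn, h1, lead_smul _ hs0, abs_mul, h2, one_mul, mul_div_assoc]

theorem measurable_sgn : Measurable sgn := by
  have h : Measurable (fun ω : ℂ => lead ![ω.im, ω.re]) := by
    simp only [lead, Matrix.cons_val_zero, Matrix.cons_val_one]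
    refine Measurable.ite ?_ Complex.measurable_im Complex.measurable_re
    exact (measurableSet_singleton (0 : ℝ)).preimage Complex.measurable_re
  exact h.div (continuous_abs.measurable.comp h)

theorem re_mul_re_nonneg_of_sgn_eq {ω ω' : ℂ} (h : sgn ω = sgn ω') : 0 ≤ ω.re * ω'.re := by
  by_contra hneg
  rcases mul_neg_iff.1 (not_le.1 hneg) with ⟨h1, h2⟩ | ⟨h1, h2⟩
  · rw [sgn_of_re_pos h1, sgn_of_re_neg h2] at h; norm_num at h
  · rw [sgn_of_re_neg h1, sgn_of_re_pos h2] at h; norm_num at h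

theorem continuous_uni_coe : Continuous (fun x : ℝ => uni (x : PLine)) := by
  simp only [uni, zeta_homog_coe]
  refine Continuous.div (by fun_prop) (by fun_prop) fun x => ?_
  rw [← zeta_homog_coe]
  exact Complex.ofReal_ne_zero.2 (norm_ne_zero_iff.2 (zeta_ne_zero (homog_ne_zero _)))

/-- With `x = cot t`, the homogeneous vector is proportional to `(cos t, sin t)`. This lets the
angle run over the line, up to a sign that odd powers preserve. -/
theorem exists_uni_cot {t : ℝ} (ht : Real.sin t ≠ 0) :
    ∃ s : ℝ, s * s = 1 ∧
      uni ((Real.cos t / Real.sin t : ℝ) : PLine) = s * Complex.exp (t * Complex.I) := by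
  refine ⟨|Real.sin t| / Real.sin t, ?_, ?_⟩
  · rw [div_mul_div_comm, abs_mul_abs_self, div_self (mul_ne_zero ht ht)]
  · have htc : ((Real.sin t : ℝ) : ℂ) ≠ 0 := Complex.ofReal_ne_zero.2 ht
    have h1 : zeta (homog ((Real.cos t / Real.sin t : ℝ) : PLine)) =
        ((Real.sin t)⁻¹ : ℝ) * Complex.exp (t * Complex.I) := by
      rw [zeta_homog_coe, Complex.exp_mul_I, ← Complex.ofReal_cos, ← Complex.ofReal_sin]
      rw [Complex.ofReal_div, Complex.ofReal_inv]
      field_simp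
    rw [uni, h1, norm_mul, Complex.norm_exp_ofReal_mul_I, mul_one, Complex.norm_real,
      Real.norm_eq_abs, abs_inv]
    have hta : ((|Real.sin t| : ℝ) : ℂ) ≠ 0 := Complex.ofReal_ne_zero.2 (abs_ne_zero.2 ht)
    rw [Complex.ofReal_inv, Complex.ofReal_inv, Complex.ofReal_div]
    field_simp

/-- If a rotation by `c` does not change the sign of the real part, then `cos(t + c) cos t ≥ 0` for
almost all, hence by continuity all, phases `t`. At `t = (π - c)/2` this product is `-sin²(c/2)`, so
`c` lies in `2πℤ`. -/
theorem exp_eq_one_of_sgn {n : ℤ} (hn : Odd n) {c u : ℝ}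
    (h : ∀ᵐ y ∂lam1,
      sgn (Complex.exp (c * Complex.I) * (Complex.exp (u * Complex.I) * uni y ^ n)) =
        sgn (Complex.exp (u * Complex.I) * uni y ^ n)) :
    Complex.exp (c * Complex.I) = 1 := by
  rw [ae_lam1_iff] at h
  set G : ℝ → ℝ := fun y =>
    (Complex.exp (c * Complex.I) * (Complex.exp (u * Complex.I) * uni (y : PLine) ^ n)).re *
      (Complex.exp (u * Complex.I) * uni (y : PLine) ^ n).re with hG
  have hGc : Continuous G := by
    have h1 : Continuous (fun y : ℝ => uni (y : PLine) ^ n) :=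
      continuous_uni_coe.zpow₀ n fun y => Or.inl (uni_ne_zero _)
    exact (Complex.continuous_re.comp (continuous_const.mul (continuous_const.mul h1))).mul
      (Complex.continuous_re.comp (continuous_const.mul h1))
  -- A negative value would persist on a nonempty open set, which has positive measure.
  have hG0 : ∀ y, 0 ≤ G y := by
    by_contra hcon
    push Not at hcon
    have ho : IsOpen {y | G y < 0} := isOpen_lt hGc continuous_const
    have h2 : volume {y | G y < 0} = 0 := by
      rw [← nonpos_iff_eq_zero, ← ae_iff.1 h]
      refine measure_mono fun y hy hy' => ?_
      exact absurd (re_mul_re_nonneg_of_sgn_eq hy') (not_le.2 hy)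
    exact (ho.measure_pos volume hcon).ne' h2
  have hcos : ∀ t : ℝ, 0 ≤ Real.cos (n * t + u + c) * Real.cos (n * t + u) := by
    have hdense : Dense {t : ℝ | Real.sin t = 0}ᶜ := by
      refine Set.Countable.dense_compl ℝ ?_
      have : {t : ℝ | Real.sin t = 0} = Set.range fun k : ℤ => (k : ℝ) * Real.pi := by
        ext t; exact Real.sin_eq_zero_iff
      rw [this]
      exact Set.countable_range _
    have hcl : IsClosed {t : ℝ | 0 ≤ Real.cos (n * t + u + c) * Real.cos (n * t + u)} :=
      isClosed_le continuous_const (by fun_prop)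
    have hsub : {t : ℝ | Real.sin t = 0}ᶜ ⊆
        {t : ℝ | 0 ≤ Real.cos (n * t + u + c) * Real.cos (n * t + u)} := by
      intro t ht
      obtain ⟨s, hs, hu⟩ := exists_uni_cot ht
      have h3 := hG0 (Real.cos t / Real.sin t)
      have hsc : (s : ℂ) * s = 1 := by rw [← Complex.ofReal_mul, hs, Complex.ofReal_one]
      have e1 : Complex.exp (u * Complex.I) * (s * Complex.exp (n * (t * Complex.I))) =
          s * Complex.exp ((n * t + u : ℝ) * Complex.I) := by
        rw [mul_left_comm, ← Complex.exp_add]; push_cast; congr 2; ring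
      have e2 : Complex.exp (c * Complex.I) * (s * Complex.exp ((n * t + u : ℝ) * Complex.I)) =
          s * Complex.exp ((n * t + u + c : ℝ) * Complex.I) := by
        rw [mul_left_comm, ← Complex.exp_add]; push_cast; congr 2; ring
      simp only [hG, hu] at h3
      rw [mul_zpow, zpow_odd_of_sq_eq_one hsc hn, ← Complex.exp_int_mul, e1, e2,
        Complex.re_ofReal_mul, Complex.re_ofReal_mul, Complex.exp_ofReal_mul_I_re,
        Complex.exp_ofReal_mul_I_re] at h3
      have h4 : s * Real.cos (n * t + u + c) * (s * Real.cos (n * t + u)) =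
          Real.cos (n * t + u + c) * Real.cos (n * t + u) := by
        linear_combination Real.cos (n * t + u + c) * Real.cos (n * t + u) * hs
      rw [h4] at h3
      exact h3
    intro t
    have := hdense.closure_eq ▸ closure_minimal hsub hcl
    exact this (Set.mem_univ t)
  have hn0 : (n : ℝ) ≠ 0 := by
    intro h0
    have : n = 0 := by exact_mod_cast h0
    simp [this] at hn
  have h5 := hcos (((Real.pi - c) / 2 - u) / n)
  rw [mul_div_cancel₀ _ hn0, show (Real.pi - c) / 2 - u + u + c = Real.pi / 2 + c / 2 by ring,
    show (Real.pi - c) / 2 - u + u = Real.pi / 2 - c / 2 by ring, Real.cos_pi_div_two_sub,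
    add_comm, Real.cos_add_pi_div_two] at h5
  have h6 : Real.sin (c / 2) = 0 := by nlinarith
  obtain ⟨k, hk⟩ := Real.sin_eq_zero_iff.1 h6
  rw [exp_mul_I_eq_one_iff]
  exact ⟨k, by linarith⟩

/-- A step function on the torus attached to a pair of characters. -/
def stepFun (a b : ℤ × ℤ) (z : Torus) : ℝ := 2 * sgn (chr a.1 a.2 z) + sgn (chr b.1 b.2 z)

theorem abs_stepFun (a b : ℤ × ℤ) (z : Torus) : |stepFun a b z| = 1 ∨ |stepFun a b z| = 3 := by
  unfold stepFun
  rcases sgn_eq_or (chr_ne_zero a.1 a.2 z) with h1 | h1 <;>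
    rcases sgn_eq_or (chr_ne_zero b.1 b.2 z) with h2 | h2 <;> rw [h1, h2] <;> norm_num

theorem memLp_stepFun (a b : ℤ × ℤ) : MemLp (stepFun a b) 2 lam := by
  refine MemLp.of_bound ?_ 3 (Filter.Eventually.of_forall fun z => ?_)
  · exact (((measurable_sgn.comp (measurable_chr _ _)).const_mul 2).add
      (measurable_sgn.comp (measurable_chr _ _))).aestronglyMeasurable
  · rw [Real.norm_eq_abs]
    rcases abs_stepFun a b z with h | h <;> rw [h] <;> norm_num

/-- The functional with density `stepFun a b`. -/
def stepFunctional (a b : ℤ × ℤ) : StrongDual ℝ L2 := ofDensity (memLp_stepFun a b).toLp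

theorem exists_of_ae_lam1 {P : PLine → Prop} (h : ∀ᵐ x ∂lam1, P x) : ∃ x, P x :=
  let ⟨x, hx⟩ := (ae_lam1_iff.1 h).exists
  ⟨x, hx⟩

theorem stepFunctional_ne_zero (a b : ℤ × ℤ) : stepFunctional a b ≠ 0 := by
  intro h
  have h1 : density (stepFunctional a b) = 0 := by
    rw [h]; simp [density]
  have h2 : (0 : L2) =ᵐ[lam] stepFun a b := by
    rw [← h1, stepFunctional, density_ofDensity]
    exact (memLp_stepFun a b).coeFn_toLp
  have h3 : ∀ᵐ z ∂lam, stepFun a b z = 0 := by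
    filter_upwards [h2, Lp.coeFn_zero ℝ 2 lam] with z hz hz'
    rw [← hz, hz']; rfl
  obtain ⟨x, hx⟩ := exists_of_ae_lam1 (Measure.ae_ae_of_ae_prod h3)
  obtain ⟨y, hy⟩ := exists_of_ae_lam1 hx
  rcases abs_stepFun a b (x, y) with h | h <;> rw [hy] at h <;> norm_num at h

theorem littleGroup_stepFunctional_le (a b : ℤ × ℤ) : littleGroup (stepFunctional a b) ≤ torusK := by
  intro p hp
  have h1 := (mem_littleGroup_ofDensity_iff _ p).1 hp
  -- The functional equation makes `kProd ^ 3` a quotient of two values of `|stepFun|`, each 1 or 3,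
  -- so `kProd` takes finitely many values. Freezing one variable then shows that each component is
  -- a rotation.
  set T : Set ℝ := {r | r ^ 3 ∈ ({1, 3, 1 / 3} : Set ℝ)} with hT
  have hTf : T.Finite := Set.Finite.preimage
    ((Odd.strictMono_pow (by decide : Odd 3)).injective.injOn) (Set.toFinite _)
  have h2 : ∀ᵐ z ∂lam, kProd p z ∈ T := by
    filter_upwards [h1] with z hz
    have h3 := congrArg abs hz
    have hk := kProd_pos p z
    rw [abs_mul, abs_mul, abs_mult, abs_of_pos (pow_pos hk 2)] at h3
    change kProd p z ^ 3 ∈ ({1, 3, 1 / 3} : Set ℝ)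
    simp only [Set.mem_insert_iff, Set.mem_singleton_iff]
    rcases abs_stepFun a b z with h4 | h4 <;> rcases abs_stepFun a b (tact p z) with h5 | h5 <;>
      rw [h4, h5] at h3
    · left; linarith
    · right; left; linarith
    · right; right; linarith
    · left; linarith
  have h3 := Measure.ae_ae_of_ae_prod h2
  have hsnd : p.2 ∈ SO2 := by
    obtain ⟨x, hx⟩ := exists_of_ae_lam1 h3
    refine mem_SO2_of_ae_kFac_mem (hTf.image fun r => r / kFac p.1 x) (hx.mono fun y hy => ?_)
    refine ⟨_, hy, ?_⟩
    have := (kFac_pos p.1 x).ne'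
    simp only [kProd]
    field_simp
  refine ⟨mem_SO2_of_ae_kFac_mem hTf (h3.mono fun x hx => ?_), hsnd⟩
  obtain ⟨y, hy⟩ := exists_of_ae_lam1 hx
  obtain ⟨θ, hθ⟩ := hsnd
  simpa [kProd, ← hθ, kFac_rot] using hy

/-- The unequal weights 2 and 1 let the value `±2 ± 1` determine both signs. Invariance thus splits
into invariance for each character, to which `exp_eq_one_of_sgn` applies on a slice in the second
variable. -/
theorem rot_mem_littleGroup_stepFunctional_iff {a b : ℤ × ℤ} (ha : Odd a.1 ∧ Odd a.2)
    (hb : Odd b.1 ∧ Odd b.2) (θ ψ : ℝ) :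
    (rot θ, rot ψ) ∈ littleGroup (stepFunctional a b) ↔
      (∃ k : ℤ, a.1 * θ + a.2 * ψ = 2 * Real.pi * k) ∧
        ∃ k : ℤ, b.1 * θ + b.2 * ψ = 2 * Real.pi * k := by
  have hms : ∀ z, mult (rot θ, rot ψ) z * mult (rot θ, rot ψ) z = 1 := fun z => by
    exact_mod_cast mult_rot_sq θ ψ z
  have hact : ∀ {a : ℤ × ℤ}, Odd a.1 ∧ Odd a.2 → ∀ z,
      sgn (chr a.1 a.2 (tact (rot θ, rot ψ) z)) = mult (rot θ, rot ψ) z *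
        sgn (Complex.exp ((a.1 * θ + a.2 * ψ : ℝ) * Complex.I) * chr a.1 a.2 z) :=
    fun ha z => by rw [chr_tact_rot ha.1 ha.2, sgn_real_mul (hms z)]
  have hexp : ∀ {a : ℤ × ℤ}, Odd a.2 → (∀ᵐ z ∂lam,
      sgn (Complex.exp ((a.1 * θ + a.2 * ψ : ℝ) * Complex.I) * chr a.1 a.2 z) =
        sgn (chr a.1 a.2 z)) →
      Complex.exp ((a.1 * θ + a.2 * ψ : ℝ) * Complex.I) = 1 := fun {a} ha h => by
    obtain ⟨x, hx⟩ := exists_of_ae_lam1 (Measure.ae_ae_of_ae_prod h)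
    have hn : ‖uni x ^ a.1‖ = 1 := by rw [norm_zpow, norm_uni, one_zpow]
    have hu := Complex.norm_mul_exp_arg_mul_I (uni x ^ a.1)
    rw [hn, Complex.ofReal_one, one_mul] at hu
    refine exp_eq_one_of_sgn ha (u := (uni x ^ a.1).arg) ?_
    rw [hu]
    exact hx
  rw [stepFunctional, mem_littleGroup_ofDensity_iff]
  simp only [kProd_rot, one_pow, mul_one, stepFun, hact ha, hact hb]
  rw [← exp_mul_I_eq_one_iff, ← exp_mul_I_eq_one_iff]
  constructor
  · intro h
    have hne : ∀ z, Complex.exp ((a.1 * θ + a.2 * ψ : ℝ) * Complex.I) * chr a.1 a.2 z ≠ 0 :=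
      fun z => mul_ne_zero (Complex.exp_ne_zero _) (chr_ne_zero _ _ _)
    have hne' : ∀ z, Complex.exp ((b.1 * θ + b.2 * ψ : ℝ) * Complex.I) * chr b.1 b.2 z ≠ 0 :=
      fun z => mul_ne_zero (Complex.exp_ne_zero _) (chr_ne_zero _ _ _)
    have h1 : ∀ᵐ z ∂lam,
        sgn (Complex.exp ((a.1 * θ + a.2 * ψ : ℝ) * Complex.I) * chr a.1 a.2 z) =
          sgn (chr a.1 a.2 z) ∧
        sgn (Complex.exp ((b.1 * θ + b.2 * ψ : ℝ) * Complex.I) * chr b.1 b.2 z) =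
          sgn (chr b.1 b.2 z) := by
      filter_upwards [h] with z hz
      have hm : mult (rot θ, rot ψ) z ≠ 0 := mult_ne_zero _ _
      have h2 : 2 * sgn (Complex.exp ((a.1 * θ + a.2 * ψ : ℝ) * Complex.I) * chr a.1 a.2 z) +
          sgn (Complex.exp ((b.1 * θ + b.2 * ψ : ℝ) * Complex.I) * chr b.1 b.2 z) =
          2 * sgn (chr a.1 a.2 z) + sgn (chr b.1 b.2 z) :=
        mul_left_cancel₀ hm (by linear_combination hz)
      rcases sgn_eq_or (hne z) with e1 | e1 <;> rcases sgn_eq_or (hne' z) with e2 | e2 <;>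
        rcases sgn_eq_or (chr_ne_zero a.1 a.2 z) with e3 | e3 <;>
        rcases sgn_eq_or (chr_ne_zero b.1 b.2 z) with e4 | e4 <;>
        simp only [e1, e2, e3, e4] at h2 ⊢ <;> norm_num at h2 <;> norm_num
    exact ⟨hexp ha.2 (h1.mono fun z hz => hz.1), hexp hb.2 (h1.mono fun z hz => hz.2)⟩
  · rintro ⟨h1, h2⟩
    refine Filter.Eventually.of_forall fun z => ?_
    rw [h1, h2, one_mul, one_mul]
    ring

/-! ### Finite subgroups of the torus as kernels of two characters. -/

theorem exists_int_of_rot_mem_cyc {n : ℕ} {θ : ℝ} (hn : 0 < n) (h : rot θ ∈ cyc n) :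
    ∃ k : ℤ, (n : ℝ) * θ = 2 * Real.pi * k := by
  have hn' : (n : ℝ) ≠ 0 := by exact_mod_cast hn.ne'
  obtain ⟨i, hi⟩ := h
  simp only at hi
  rw [← rot_zpow] at hi
  obtain ⟨j, hj⟩ := rot_eq_rot_iff.1 hi.symm
  refine ⟨i + n * j, ?_⟩
  rw [hj]
  push_cast
  field_simp

/-- A finite subgroup of the torus is cut out by two characters. -/
theorem exists_characters_of_le_cyc {F : Subgroup GG} {n m : ℕ} (hn : 0 < n) (hm : 0 < m)
    (hF : F ≤ (cyc n).prod (cyc m)) :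
    ∃ a b : ℤ × ℤ, ∀ θ ψ : ℝ, (rot θ, rot ψ) ∈ F ↔
      (∃ k : ℤ, a.1 * θ + a.2 * ψ = 2 * Real.pi * k) ∧
        ∃ k : ℤ, b.1 * θ + b.2 * ψ = 2 * Real.pi * k := by
  set d : ℤ := n * m with hd
  have hd0 : d ≠ 0 := by positivity
  have hdr : (d : ℝ) ≠ 0 := by exact_mod_cast hd0
  -- Measured in units of `2π / d`, the angles of elements of `F` form a lattice `G` containing `d
  -- ℤ²`.
  let G : AddSubgroup (ℤ × ℤ) :=
    { carrier := {x | (rot (2 * Real.pi * x.1 / d), rot (2 * Real.pi * x.2 / d)) ∈ F}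
      zero_mem' := by
        simp only [Set.mem_ofPred_eq, Prod.fst_zero, Prod.snd_zero, Int.cast_zero, mul_zero,
          zero_div, rot_zero]
        exact F.one_mem
      add_mem' := by
        intro x y hx hy
        have := F.mul_mem hx hy
        rw [Prod.mk_mul_mk, ← rot_add, ← rot_add] at this
        have e : ∀ i j : ℤ, 2 * Real.pi * (i + j : ℤ) / d =
            2 * Real.pi * i / d + 2 * Real.pi * j / d := fun i j => by push_cast; ring
        rw [← e, ← e] at this
        exact this
      neg_mem' := by
        intro x hx
        have := F.inv_mem hx
        rw [Prod.inv_mk, ← rot_neg, ← rot_neg] at this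
        have e : ∀ i : ℤ, 2 * Real.pi * (-i : ℤ) / d = -(2 * Real.pi * i / d) :=
          fun i => by push_cast; ring
        rw [← e, ← e] at this
        exact this }
  have hG : ∀ θ ψ : ℝ, (rot θ, rot ψ) ∈ F ↔
      ∃ x ∈ G, (d : ℝ) * θ = 2 * Real.pi * x.1 ∧ (d : ℝ) * ψ = 2 * Real.pi * x.2 := by
    intro θ ψ
    constructor
    · intro h
      obtain ⟨h1, h2⟩ := hF h
      obtain ⟨i, hi⟩ := exists_int_of_rot_mem_cyc hn h1
      obtain ⟨j, hj⟩ := exists_int_of_rot_mem_cyc hm h2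
      have e1 : (d : ℝ) * θ = 2 * Real.pi * (m * i : ℤ) := by
        rw [hd]; push_cast; linear_combination (m : ℝ) * hi
      have e2 : (d : ℝ) * ψ = 2 * Real.pi * (n * j : ℤ) := by
        rw [hd]; push_cast; linear_combination (n : ℝ) * hj
      refine ⟨(m * i, n * j), ?_, e1, e2⟩
      change (rot (2 * Real.pi * (m * i : ℤ) / d), rot (2 * Real.pi * (n * j : ℤ) / d)) ∈ F
      rw [← e1, ← e2, mul_div_cancel_left₀ _ hdr, mul_div_cancel_left₀ _ hdr]
      exact h
    · rintro ⟨x, hx, e1, e2⟩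
      have h : (rot (2 * Real.pi * x.1 / d), rot (2 * Real.pi * x.2 / d)) ∈ F := hx
      rwa [← e1, ← e2, mul_div_cancel_left₀ _ hdr, mul_div_cancel_left₀ _ hdr] at h
  have hr1 : rot (2 * Real.pi) = 1 := rot_eq_one_iff.2 ⟨1, by simp⟩
  have hr0 : rot (2 * Real.pi * (0 : ℤ) / d) = 1 := rot_eq_one_iff.2 ⟨0, by simp⟩
  have hGd1 : ((d, 0) : ℤ × ℤ) ∈ G := by
    change (rot (2 * Real.pi * d / d), rot (2 * Real.pi * (0 : ℤ) / d)) ∈ F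
    rw [mul_div_cancel_right₀ _ hdr, hr1, hr0]
    exact F.one_mem
  have hGd2 : ((0, d) : ℤ × ℤ) ∈ G := by
    change (rot (2 * Real.pi * (0 : ℤ) / d), rot (2 * Real.pi * d / d)) ∈ F
    rw [mul_div_cancel_right₀ _ hdr, hr1, hr0]
    exact F.one_mem
  -- A triangular basis of `G`: `(α, 0)` generates the horizontal part, `γ` generates the projection
  -- to the second coordinate, and `(β, γ)` is a lift of it.
  obtain ⟨α, hα⟩ := Int.subgroup_cyclic (G.comap (AddMonoidHom.inl ℤ ℤ))
  obtain ⟨γ, hγ⟩ := Int.subgroup_cyclic (G.map (AddMonoidHom.snd ℤ ℤ))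
  have hα' : ∀ x : ℤ, (x, (0 : ℤ)) ∈ G ↔ ∃ i : ℤ, i * α = x := fun x => by
    change x ∈ G.comap (AddMonoidHom.inl ℤ ℤ) ↔ _
    simp only [hα, AddSubgroup.mem_closure_singleton, smul_eq_mul]
  have hγ' : ∀ y : ℤ, (∃ x : ℤ, (x, y) ∈ G) ↔ ∃ j : ℤ, j * γ = y := fun y => by
    have h : (∃ x : ℤ, (x, y) ∈ G) ↔ y ∈ G.map (AddMonoidHom.snd ℤ ℤ) := by simp
    rw [h, hγ, AddSubgroup.mem_closure_singleton]
    simp only [smul_eq_mul]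
  obtain ⟨β, hβ⟩ := (hγ' γ).2 ⟨1, one_mul _⟩
  obtain ⟨M, hM⟩ := (hα' d).1 hGd1
  obtain ⟨k, hk⟩ := (hγ' d).1 ⟨0, hGd2⟩
  -- Here `(0, d) - k (β, γ) = (-kβ, 0)` is a horizontal element of `G`.
  obtain ⟨l, hl⟩ : ∃ l : ℤ, l * α = -(k * β) := by
    rw [← hα']
    have h := G.sub_mem hGd2 (G.zsmul_mem hβ k)
    simpa [hk] using h
  have hk0 : k ≠ 0 := fun h => hd0 (by rw [← hk, h, zero_mul])
  have hM0 : M ≠ 0 := fun h => hd0 (by rw [← hM, h, zero_mul])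
  have hrel : M * β + l * γ = 0 := by
    refine mul_left_cancel₀ hk0 ?_
    linear_combination l * hk + M * hl - l * hM
  have hkr : (k : ℝ) * γ = d := by exact_mod_cast hk
  have hMr : (M : ℝ) * α = d := by exact_mod_cast hM
  have hrelr : (M : ℝ) * β + l * γ = 0 := by exact_mod_cast hrel
  have hlr : (l : ℝ) * α = -(k * β) := by exact_mod_cast hl
  have hkr0 : (k : ℝ) ≠ 0 := by exact_mod_cast hk0
  have hMr0 : (M : ℝ) ≠ 0 := by exact_mod_cast hM0
  -- This is `d` times the dual basis: `(M, l)` takes the values `d` and `0`, and `(0, k)` the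
  -- values `0` and `d`, on `(α, 0)` and `(β, γ)`.
  refine ⟨(M, l), (0, k), fun θ ψ => ?_⟩
  rw [hG]
  constructor
  · rintro ⟨⟨X, Y⟩, hXY, e1, e2⟩
    simp only at e1 e2
    obtain ⟨j, rfl⟩ := (hγ' Y).1 ⟨X, hXY⟩
    obtain ⟨i, hi⟩ : ∃ i : ℤ, i * α = X - j * β := by
      rw [← hα']
      simpa using G.sub_mem hXY (G.zsmul_mem hβ j)
    have hir : (i : ℝ) * α = X - j * β := by exact_mod_cast hi
    push_cast at e2
    refine ⟨⟨i, mul_left_cancel₀ hdr ?_⟩, ⟨j, mul_left_cancel₀ hdr ?_⟩⟩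
    · simp only
      linear_combination (M : ℝ) * e1 + l * e2 + 2 * Real.pi * (j * hrelr - M * hir + i * hMr)
    · push_cast
      linear_combination (k : ℝ) * e2 + 2 * Real.pi * j * hkr
  · rintro ⟨⟨i, hi⟩, ⟨j, hj⟩⟩
    simp only [Int.cast_zero, zero_mul, zero_add] at hi hj
    refine ⟨(i * α + j * β, j * γ), ?_, ?_, ?_⟩
    · have h1 : ((i * α, 0) : ℤ × ℤ) ∈ G := (hα' _).2 ⟨i, rfl⟩
      simpa using G.add_mem h1 (G.zsmul_mem hβ j)
    · push_cast
      linear_combination (α : ℝ) * hi - θ * hMr - ψ * hlr + β * hj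
    · push_cast
      linear_combination (γ : ℝ) * hj - ψ * hkr

/-- Since `(-I, -I)` lies in `F`, the two exponents of each defining character have equal parity. If
both characters were even, `(-I, I)` and hence all of `D` would lie in `F`. So at least one is odd,
and adding it to an even one makes both odd without changing the common kernel. -/
theorem exists_odd_characters {F : Subgroup GG} (hF : IsClassE1 F) :
    ∃ a b : ℤ × ℤ, (Odd a.1 ∧ Odd a.2) ∧ (Odd b.1 ∧ Odd b.2) ∧
      ∀ θ ψ : ℝ, (rot θ, rot ψ) ∈ F ↔
        (∃ k : ℤ, a.1 * θ + a.2 * ψ = 2 * Real.pi * k) ∧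
          ∃ k : ℤ, b.1 * θ + b.2 * ψ = 2 * Real.pi * k := by
  obtain ⟨⟨n, m, hn, hm, hle⟩, -, h1, h2⟩ := hF
  obtain ⟨a, b, hab⟩ := exists_characters_of_le_cyc hn hm hle
  have hpi : ∀ {x y : ℤ}, x = 2 * y → x * Real.pi = 2 * Real.pi * y := fun {x y} h => by
    have : (x : ℝ) = 2 * y := by exact_mod_cast h
    rw [this]; ring
  have heven : ∀ x : ℤ × ℤ, (∃ k : ℤ, x.1 * Real.pi + x.2 * Real.pi = 2 * Real.pi * k) →
      (Odd x.1 ↔ Odd x.2) := fun x ⟨k, hk⟩ => by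
    have e : ((x.1 + x.2 : ℤ) : ℝ) = (2 * k : ℤ) := by
      refine mul_left_cancel₀ Real.pi_ne_zero ?_
      push_cast
      linear_combination hk
    have e' : x.1 + x.2 = 2 * k := by exact_mod_cast e
    rw [Int.odd_iff, Int.odd_iff]
    omega
  rw [← rot_pi, hab] at h1
  have ha := heven a h1.1
  have hb := heven b h1.2
  have hodd : Odd a.1 ∨ Odd b.1 := by
    by_contra hcon
    push Not at hcon
    obtain ⟨i, hi⟩ := Int.not_odd_iff_even.1 hcon.1
    obtain ⟨j, hj⟩ := Int.not_odd_iff_even.1 hcon.2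
    apply h2
    have e1 : ((-1, 1) : GG) ∈ F := by
      rw [← rot_pi, ← rot_zero, hab]
      refine ⟨⟨i, ?_⟩, ⟨j, ?_⟩⟩
      · rw [mul_zero, add_zero]; exact hpi (by omega)
      · rw [mul_zero, add_zero]; exact hpi (by omega)
    have e2 : ((-1, -1) : GG) ∈ F := by
      rw [← rot_pi, hab]; exact h1
    have e3 : ((1, -1) : GG) ∈ F := by
      have := F.mul_mem e1 e2
      simpa using this
    intro x hx
    rcases hx with rfl | rfl | rfl | rfl
    · exact F.one_mem
    · exact e1
    · exact e3
    · exact e2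
  rcases Int.even_or_odd a.1 with ha1 | ha1
  · have hb1 : Odd b.1 := hodd.resolve_left (Int.not_odd_iff_even.2 ha1)
    have ha2 : Even a.2 := Int.not_odd_iff_even.1 fun h => Int.not_odd_iff_even.2 ha1 (ha.2 h)
    refine ⟨a + b, b, ⟨ha1.add_odd hb1, ha2.add_odd (hb.1 hb1)⟩, ⟨hb1, hb.1 hb1⟩,
      fun θ ψ => ?_⟩
    rw [hab]
    simp only [Prod.fst_add, Prod.snd_add]
    constructor
    · rintro ⟨⟨i, hi⟩, j, hj⟩
      exact ⟨⟨i + j, by push_cast; linear_combination hi + hj⟩, j, hj⟩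
    · rintro ⟨⟨i, hi⟩, j, hj⟩
      push_cast at hi
      exact ⟨⟨i - j, by push_cast; linear_combination hi - hj⟩, j, hj⟩
  · rcases Int.even_or_odd b.1 with hb1 | hb1
    · have hb2 : Even b.2 := Int.not_odd_iff_even.1 fun h => Int.not_odd_iff_even.2 hb1 (hb.2 h)
      refine ⟨a, a + b, ⟨ha1, ha.1 ha1⟩, ⟨ha1.add_even hb1, (ha.1 ha1).add_even hb2⟩,
        fun θ ψ => ?_⟩
      rw [hab]
      simp only [Prod.fst_add, Prod.snd_add]
      constructor
      · rintro ⟨⟨i, hi⟩, j, hj⟩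
        exact ⟨⟨i, hi⟩, i + j, by push_cast; linear_combination hi + hj⟩
      · rintro ⟨⟨i, hi⟩, j, hj⟩
        push_cast at hj
        exact ⟨⟨i, hi⟩, j - i, by push_cast; linear_combination hj - hi⟩
    · exact ⟨a, b, ⟨ha1, ha.1 ha1⟩, ⟨hb1, hb.1 hb1⟩, hab⟩

/-! ### Every group of the list is an actual little group. -/

theorem isActualLittleGroup_of_characters {L : Subgroup GG} (hL : L ≤ torusK) {a b : ℤ × ℤ}
    (ha : Odd a.1 ∧ Odd a.2) (hb : Odd b.1 ∧ Odd b.2)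
    (hmem : ∀ θ ψ : ℝ, (rot θ, rot ψ) ∈ L ↔
      (∃ k : ℤ, a.1 * θ + a.2 * ψ = 2 * Real.pi * k) ∧
        ∃ k : ℤ, b.1 * θ + b.2 * ψ = 2 * Real.pi * k) :
    IsActualLittleGroup L := by
  refine ⟨stepFunctional a b, stepFunctional_ne_zero a b, ?_⟩
  ext x
  constructor
  · intro hx
    obtain ⟨θ, ψ, rfl⟩ := mem_torusK_iff.1 (littleGroup_stepFunctional_le a b hx)
    exact (hmem θ ψ).2 ((rot_mem_littleGroup_stepFunctional_iff ha hb θ ψ).1 hx)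
  · intro hx
    obtain ⟨θ, ψ, rfl⟩ := mem_torusK_iff.1 (hL hx)
    exact (rot_mem_littleGroup_stepFunctional_iff ha hb θ ψ).2 ((hmem θ ψ).1 hx)

theorem isActualLittleGroup_of_classE1 {F : Subgroup GG} (hK : F ≤ torusK) (hF : IsClassE1 F) :
    IsActualLittleGroup F := by
  obtain ⟨a, b, ha, hb, hab⟩ := exists_odd_characters hF
  exact isActualLittleGroup_of_characters hK ha hb hab

theorem groupH_le_torusK (N : ℕ) (p q : ℤ) : groupH N p q ≤ torusK := by
  rintro _ ⟨θ, ψ, rfl, -⟩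
  exact mem_torusK_iff.2 ⟨θ, ψ, rfl⟩

theorem isActualLittleGroup_groupH {N : ℕ} {p q : ℤ} (hN : Odd N) (hp : Odd p) (hq : Odd q) :
    IsActualLittleGroup (groupH N p q) := by
  have hN' : Odd (N : ℤ) := (Int.odd_coe_nat N).2 hN
  have ha : Odd (N * p : ℤ) ∧ Odd (N * q : ℤ) := ⟨hN'.mul hp, hN'.mul hq⟩
  -- A single character suffices here, so `(Np, Nq)` is taken twice.
  refine isActualLittleGroup_of_characters (groupH_le_torusK N p q) (a := (N * p, N * q))
    (b := (N * p, N * q)) ha ha fun θ ψ => ?_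
  rw [rot_mem_groupH_iff, and_self]
  refine exists_congr fun k => ?_
  push_cast
  rw [mul_add, mul_assoc (N : ℝ), mul_assoc (N : ℝ)]

theorem finite_of_classE1 {F : Subgroup GG} (hF : IsClassE1 F) : Finite F := by
  obtain ⟨⟨n, m, hn, hm, hle⟩, -⟩ := hF
  exact finite_of_le_prod_cyc hn hm hle

end HB

end

theorem mainTheorem1 :
    (∀ L : Subgroup HB.GG, HB.IsActualLittleGroup L →
      (HB.lieDim L = 1 ∧ Infinite L ∧ ∃ (g : HB.GG) (N : ℕ) (p q : ℤ), Odd N ∧ Odd p ∧ Odd q ∧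
          IsCoprime p q ∧ L.map (MulAut.conj g).toMonoidHom = HB.groupH N p q) ∨
      (HB.lieDim L = 0 ∧ Finite L ∧ ∃ g : HB.GG,
          HB.IsClassE1 (L.map (MulAut.conj g).toMonoidHom))) ∧
    (∀ L : Subgroup HB.GG, L ≤ HB.torusK →
      ((HB.IsActualLittleGroup L ∧ Infinite L) ↔
        ∃ (N : ℕ) (p q : ℤ), Odd N ∧ Odd p ∧ Odd q ∧ IsCoprime p q ∧ L = HB.groupH N p q)) ∧
    (∀ L : Subgroup HB.GG, L ≤ HB.torusK →
      ((HB.IsActualLittleGroup L ∧ Finite L) ↔ HB.IsClassE1 L)) := by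
  have hodd : ∀ {z : ℤ}, Odd z → z ≠ 0 := fun h h0 => by simp [h0] at h
  have hmain : ∀ L : Subgroup HB.GG, L ≤ HB.torusK → HB.IsActualLittleGroup L →
      HB.IsClassE1 L ∨ ∃ (N : ℕ) (p q : ℤ), Odd N ∧ Odd p ∧ Odd q ∧ IsCoprime p q ∧
        L = HB.groupH N p q := by
    rintro _ hL ⟨φ, hφ, rfl⟩
    exact HB.littleGroup_classE1_or_groupH hφ hL
  refine ⟨fun L hL => ?_, fun L hL => ⟨?_, ?_⟩, fun L hL => ⟨?_, ?_⟩⟩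
  · obtain ⟨g, hg | ⟨N, p, q, hN, hp, hq, hpq, hg⟩⟩ := HB.exists_conj_classE1_or_groupH hL
    · have hfin := HB.finite_of_classE1 hg
      have e := (Subgroup.equivMapOfInjective L (MulAut.conj g).toMonoidHom
        (MulAut.conj g).injective).toEquiv
      have hLfin : Finite L := Finite.of_equiv _ e.symm
      exact Or.inr ⟨HB.lieDim_eq_zero_of_finite hLfin, hLfin, g, hg⟩
    · have e := (Subgroup.equivMapOfInjective L (MulAut.conj g).toMonoidHom
        (MulAut.conj g).injective).toEquiv
      rw [hg] at e
      have hinf := HB.infinite_groupH (N := N) (p := p) (hodd hq)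
      refine Or.inl ⟨?_, Infinite.of_injective e.symm e.symm.injective, g, N, p, q, hN, hp, hq,
        hpq, hg⟩
      rw [← HB.lieDim_map_conj L g, hg]
      exact HB.lieDim_groupH hN.pos.ne' (hodd hq)
  · rintro ⟨h, hinf⟩
    refine (hmain L hL h).resolve_left fun hE => ?_
    exact not_finite_iff_infinite.2 hinf (HB.finite_of_classE1 hE)
  · rintro ⟨N, p, q, hN, hp, hq, -, rfl⟩
    exact ⟨HB.isActualLittleGroup_groupH hN hp hq, HB.infinite_groupH (hodd hq)⟩
  · rintro ⟨h, hfin⟩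
    refine (hmain L hL h).resolve_right ?_
    rintro ⟨N, p, q, -, -, hq, -, rfl⟩
    exact not_finite_iff_infinite.2 (HB.infinite_groupH (hodd hq)) hfin
  · intro hE
    exact ⟨HB.isActualLittleGroup_of_classE1 hL hE, HB.finite_of_classE1 hE⟩
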